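/- Let $r\ge 1$, let $G_1,\dots,G_r$ be finite groups and let $G=G_1*\cdots*G_r$ be their free product. For each $k$ let $S_k\subseteq G_k\setminus\{e_k\}$ be a generating set of $G_k$, put $S=\bigcup_k S_k$, and let $|x|$ denote the word length of $x\in G$, i.e. the graph distance from $e$ to $x$ in the (undirected) Cayley graph of $G$ with respect to $S$. Let $\mu=\sum_{k=1}^r\alpha_k\mu_k$, where $\mu_k$ is a probability measure on $G_k$ (viewed as a subgroup of $G$), $\alpha_k>0$ for every $k$ and $\sum_k\alpha_k=1$. Let $(Y_n)_{n\ge 0}$ be the random walk on $G$ with $Y_0=e$ and step law $\mu$, i.e. with transition probabilities $p(x,y)=\mu(x^{-1}y)$. Set $$\ell=\lim_{n\to\infty}\frac{\mathbb E|Y_n|}{n},\qquad \Lambda(t)=\lim_{n\to\infty}\frac1n\log\mathbb E\big[e^{t|Y_n|}\big]\ (t\in\mathbb R),\qquad I(x)=\sup_{t\in\mathbb R}\{xt-\Lambda(t)\}\in[0,\infty],$$ and $D_I=\{x\ge 0: I(x)<\infty\}$; $I$ is the large deviation rate function of $|Y_n|/n$. Let $\pi$ be a probability distribution on $\{0,1,2,\dots\}$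 with $\pi(0)=0$ and mean $\rho=\sum_k k\,\pi(k)$ satisfying $1<\rho<\infty$, and define $$v_{\max}=\begin{cases}\sup\{x\in\mathbb R: I(x)=\log\rho\}, & \text{if }\log\rho\in I([\ell,\infty)),\\ \sup D_I, & \text{otherwise.}\end{cases}$$ Let $\mathbb T$ be the Galton–Watson tree with offspring law $\pi$, with root $\emptyset$ and $|v|$ the generation of $v\in\mathbb T$. Let $(\zeta_v)$ be i.i.d. with law $\mu$, independent of $\mathbb T$, and let $X_\emptyset=e$ and $X_v=\zeta_{v_1}\zeta_{v_2}\cdots\zeta_{v_n}$ for $|v|=n$, where $v_j$ is the ancestor of $v$ in generation $j$ (so $v_n=v$). Then $$\lim_{n\to\infty}\frac{\max_{|v|=n}|X_v|}{n}=v_{\max}\qquad\text{almost surely.}$$ -/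

import Mathlib

open MeasureTheory ProbabilityTheory Filter Topology

namespace FreeProductBRW

noncomputable section

/-! ### Words and lengths in the free product -/

/-- The generating set `S = ⋃ₖ Sₖ` of the free product of the groups `G k`, each factor being
embedded in the free product in the canonical way. -/
def generators {r : ℕ} {G : Fin r → Type*} [∀ k, Group (G k)] (S : ∀ k, Set (G k)) :
    Set (Monoid.CoprodI G) :=
  ⋃ k, (Monoid.CoprodI.of : G k →* Monoid.CoprodI G) '' S k

/-- The word length `|x|` of `x` with respect to `S`: the distance from the identity to `x` in the
(undirected) Cayley graph, in which `u ≠ v` are joined when `u⁻¹ v ∈ S` or `v⁻¹ u ∈ S`. -/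
def wordLength {Γ : Type*} [Group Γ] (S : Set Γ) (x : Γ) : ℕ :=
  (SimpleGraph.mulCayley S).dist 1 x

/-! ### The random walk -/

/-- The step law `μ = ∑ₖ αₖ μₖ` on the free product: choose a factor `k` with probability `αₖ`, then
an element of that factor according to `μₖ`. -/
def stepLaw {r : ℕ} {G : Fin r → Type*} [∀ k, Group (G k)] (α : PMF (Fin r))
    (μ : ∀ k, PMF (G k)) : PMF (Monoid.CoprodI G) :=
  α.bind fun k => (μ k).map (Monoid.CoprodI.of : G k →* Monoid.CoprodI G)

/-- The law of `Yₙ`, where `(Yₙ)` is the random walk with step law `μ` started at the identity,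
i.e. the Markov chain with `Y₀ = 1` and transition probabilities `p(x, y) = μ(x⁻¹ y)`. -/
def walkLaw {Γ : Type*} [Group Γ] (μ : PMF Γ) : ℕ → PMF Γ
  | 0 => PMF.pure 1
  | n + 1 => (walkLaw μ n).bind fun x => μ.map fun g => x * g

/-- The drift `ℓ = lim 𝔼|Yₙ| / n`. -/
def drift {Γ : Type*} [Group Γ] [MeasurableSpace Γ] (S : Set Γ) (μ : PMF Γ) : ℝ :=
  limUnder atTop fun n : ℕ => (∫ y, (wordLength S y : ℝ) ∂(walkLaw μ n).toMeasure) / n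

/-- `Λₙ(t) = (1/n) log 𝔼[exp (t |Yₙ|)]`. -/
def logMGF {Γ : Type*} [Group Γ] [MeasurableSpace Γ] (S : Set Γ) (μ : PMF Γ) (n : ℕ) (t : ℝ) : ℝ :=
  (1 / n) * Real.log (∫ y, Real.exp (t * wordLength S y) ∂(walkLaw μ n).toMeasure)

/-- `Λ(t) = lim Λₙ(t)`. -/
def limLogMGF {Γ : Type*} [Group Γ] [MeasurableSpace Γ] (S : Set Γ) (μ : PMF Γ) (t : ℝ) : ℝ :=
  limUnder atTop fun n : ℕ => logMGF S μ n t

/-- The large deviation rate function of `|Yₙ| / n`: the Legendre–Fenchel transform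
`I(x) = sup_t (x t - Λ(t))`, with values in the extended reals. -/
def rateFunction {Γ : Type*} [Group Γ] [MeasurableSpace Γ] (S : Set Γ) (μ : PMF Γ) (x : ℝ) :
    EReal :=
  ⨆ t : ℝ, ((x * t - limLogMGF S μ t : ℝ) : EReal)

/-- The domain of finiteness `D_I = {x ≥ 0 : I(x) < ∞}`. -/
def rateDomain {Γ : Type*} [Group Γ] [MeasurableSpace Γ] (S : Set Γ) (μ : PMF Γ) : Set ℝ :=
  {x : ℝ | 0 ≤ x ∧ rateFunction S μ x < ⊤}

open Classical in
/-- The speed `v_max`: the largest solution of `I(x) = log ρ` if `log ρ ∈ I([ℓ, ∞))`, and the right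
endpoint of `D_I` otherwise. -/
def vMax {Γ : Type*} [Group Γ] [MeasurableSpace Γ] (S : Set Γ) (μ : PMF Γ) (ρ : ℝ) : ℝ :=
  if ((Real.log ρ : ℝ) : EReal) ∈ rateFunction S μ '' Set.Ici (drift S μ) then
    sSup {x : ℝ | rateFunction S μ x = ((Real.log ρ : ℝ) : EReal)}
  else
    sSup (rateDomain S μ)

/-! ### The branching random walk

Particles carry Ulam–Harris labels, written as lists of natural numbers with the youngest generation
first: the root is `[]` and the children of `v` are `0 :: v, 1 :: v, 2 :: v, …`. -/

/-- The vertices of generation `n` of the tree in which `v` has `N v` children. -/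
def generation (N : List ℕ → ℕ) : ℕ → Finset (List ℕ)
  | 0 => {[]}
  | n + 1 => (generation N n).biUnion fun v => (Finset.range (N v)).image fun k => k :: v

/-- The position `X_v`: the product of the steps `ζ` along the ancestral line of `v`, from the oldest
ancestor after the root down to `v` itself; the root sits at the identity. -/
def position {Γ : Type*} [Group Γ] (ζ : List ℕ → Γ) : List ℕ → Γ
  | [] => 1
  | k :: v => position ζ v * ζ (k :: v)

/-- `N` and `ζ` drive a branching random walk with offspring law `π` and step law `μ`: the offspring
numbers `N v` are i.i.d. with law `π`, the steps `ζ v` are i.i.d. with law `μ`, and the two families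
are independent of each other. -/
structure IsBranchingRandomWalk {Γ : Type*} [MeasurableSpace Γ] {Ω : Type*} [MeasurableSpace Ω]
    (P : Measure Ω) (π : PMF ℕ) (μ : PMF Γ) (N : List ℕ → Ω → ℕ) (ζ : List ℕ → Ω → Γ) : Prop where
  measurable_offspring : ∀ v, Measurable (N v)
  measurable_step : ∀ v, Measurable (ζ v)
  law_offspring : ∀ v, P.map (N v) = π.toMeasure
  law_step : ∀ v, P.map (ζ v) = μ.toMeasure
  indep_offspring : iIndepFun N P
  indep_step : iIndepFun ζ P
  indep_offspring_step : IndepFun (fun ω v => N v ω) (fun ω v => ζ v ω) P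

/-- The maximal displacement `max {|X_v| : |v| = n}` (a supremum over a finite set of natural
numbers, which is nonempty when every particle has at least one child). -/
def maxDisplacement {Γ : Type*} [Group Γ] (S : Set Γ) (N : List ℕ → ℕ) (ζ : List ℕ → Γ)
    (n : ℕ) : ℕ :=
  (generation N n).sup fun v => wordLength S (position ζ v)

end

end FreeProductBRW

/-!
The theorem holds for every random walk with bounded steps on a countable group whose word length is
*almost additive* (`AlmostAdditive`): started at any `g`, the walk has, up to a constant factor and a
constant shift, at least the same chance to gain length `y` as when it is started at the identity.
In the free product this is the case because reduced words whose concatenation is reduced have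
additive length (`wordLength_prod_mul_prod`): if two factors carry nontrivial steps, then one of the
products `u v`, `u a v`, `u b v`, with `a`, `b` such steps, is as long as `u` and `v` together
(`exists_separator`). If at most one factor carries nontrivial steps, then the walk is bounded
and almost additivity is trivial.

*Large deviations.* By Fekete's lemma the drift and `Λ` exist, and `Λ t ≥ t ℓ`, so that above `ℓ`
only parameters `t ≥ 0` matter for the rate function `I`. Almost additivity makes the tails
`c ℙ(|Yₙ| ≥ y + K)` supermultiplicative in `(n, y)`. Hence their exponential rates are convex and
have supporting lines at rational slopes (`exists_supporting_line`); such a line bounds `Λ`, hence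
bounds `I` from below, so that tails decay no faster than `I` tells (`exists_lt_scaledTail`). Being
convex and lower semicontinuous, `I` is less than `log ρ` at points beyond any `v < vMax`
(`exists_rateFunction_lt`) and exceeds `log ρ` beyond `vMax` (`exists_lt_of_vMax_lt`).

*Upper bound.* For `x > vMax` the expected number of particles of generation `n` at distance at
least `x n` is `ρⁿ ℙ(|Yₙ| ≥ x n)` up to boundary terms, which is summable by Chernoff's bound; the
Borel–Cantelli lemma applies (`ae_eventually_lt`).

*Lower bound.* For rational `v < vMax` there is an `m` such that, from any position, the expected
number of descendants after `m` generations which have gained length `m v` is larger than one. A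
uniform first-moment argument, valid for small probabilities (`exists_offspring_bound`), shows that
an infinite line of descent consisting of such blocks exists with positive probability
(`le_fieldLaw_chainEvent`). Failing to have speed `v` is inherited by the subtrees of all children
of the root, so that its probability `s < 1` satisfies `s ≤ ∑ π(k) sᵏ` and has to vanish
(`fieldLaw_eq_zero_of_inherited`). The branching property used here is the statement that an
independent field over the Ulam–Harris labels is made of its value at the root and of independent
copies of itself on the subtrees (`measurePreserving_graft`).
-/

namespace FreeProductBRW

/-! ### Word length in a group -/

section WordLength

variable {Γ : Type*} [Group Γ] {S : Set Γ}

lemma mulCayley_connected (hS : Subgroup.closure S = ⊤) : (SimpleGraph.mulCayley S).Connected := by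
  have key : ∀ x : Γ, (SimpleGraph.mulCayley S).Reachable 1 x := by
    intro x
    have hx : x ∈ Subgroup.closure S := hS ▸ Subgroup.mem_top x
    have step : ∀ u v : Γ, (u⁻¹ * v ∈ S ∨ v⁻¹ * u ∈ S) →
        (SimpleGraph.mulCayley S).Reachable u v := by
      intro u v h
      by_cases huv : u = v
      · exact huv ▸ SimpleGraph.Reachable.refl u
      · exact ((SimpleGraph.mulCayley_adj S u v).2 ⟨huv, h⟩).reachable
    induction hx using Subgroup.closure_induction_right with
    | one => exact SimpleGraph.Reachable.refl _
    | mul_right x y _ hy ih => exact ih.trans (step _ _ (Or.inl (by simpa using hy)))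
    | mul_inv_cancel x y _ hy ih => exact ih.trans (step _ _ (Or.inr (by simpa using hy)))
  have : Nonempty Γ := ⟨1⟩
  exact ⟨fun u v => (key u).symm.trans (key v)⟩

lemma wordLength_one : wordLength S (1 : Γ) = 0 := SimpleGraph.dist_self

/-- Left multiplication as a graph endomorphism of the Cayley graph. -/
def leftMulHom (S : Set Γ) (d : Γ) :
    SimpleGraph.mulCayley S →g SimpleGraph.mulCayley S where
  toFun x := d * x
  map_rel' h := SimpleGraph.mulCayley_adj_mul_iff_right.2 h

lemma dist_mul_left_le (hS : Subgroup.closure S = ⊤) (d u v : Γ) :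
    (SimpleGraph.mulCayley S).dist (d * u) (d * v) ≤ (SimpleGraph.mulCayley S).dist u v := by
  obtain ⟨p, hp⟩ := (mulCayley_connected hS).exists_walk_length_eq_dist u v
  rw [← hp, ← SimpleGraph.Walk.length_map (leftMulHom S d) p]
  exact SimpleGraph.dist_le _

lemma wordLength_mul_le (hS : Subgroup.closure S = ⊤) (x y : Γ) :
    wordLength S (x * y) ≤ wordLength S x + wordLength S y := by
  have h := (mulCayley_connected hS).dist_triangle (u := 1) (v := x) (w := x * y)
  have h' := dist_mul_left_le hS x 1 y
  rw [mul_one] at h'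
  unfold wordLength
  omega

lemma wordLength_inv_le (hS : Subgroup.closure S = ⊤) (x : Γ) :
    wordLength S x⁻¹ ≤ wordLength S x := by
  have h' := dist_mul_left_le hS x⁻¹ x 1
  rw [inv_mul_cancel, mul_one, SimpleGraph.dist_comm (u := x)] at h'
  exact h'

lemma wordLength_inv (hS : Subgroup.closure S = ⊤) (x : Γ) :
    wordLength S x⁻¹ = wordLength S x :=
  le_antisymm (wordLength_inv_le hS x) (by simpa using wordLength_inv_le hS x⁻¹)

lemma wordLength_le_mul_left (hS : Subgroup.closure S = ⊤) (x y : Γ) :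
    wordLength S y ≤ wordLength S x + wordLength S (x * y) := by
  have h := wordLength_mul_le hS x⁻¹ (x * y)
  rwa [inv_mul_cancel_left, wordLength_inv hS] at h

lemma wordLength_le_mul_right (hS : Subgroup.closure S = ⊤) (x y : Γ) :
    wordLength S x ≤ wordLength S (x * y) + wordLength S y := by
  have h := wordLength_mul_le hS (x * y) y⁻¹
  rwa [mul_inv_cancel_right, wordLength_inv hS] at h

lemma wordLength_le_one {s : Γ} (hs : s ∈ S) : wordLength S s ≤ 1 := by
  by_cases h : s = 1
  · simp [h, wordLength_one]
  · refine (SimpleGraph.dist_eq_one_iff_adj.2 ((SimpleGraph.mulCayley_adj S 1 s).2 ?_)).le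
    exact ⟨fun h' => h h'.symm, Or.inl (by simpa using hs)⟩

/-- The word length is the largest function vanishing at the identity that grows by at most one
under left multiplication by a generator or its inverse. -/
lemma le_wordLength (hS : Subgroup.closure S = ⊤) (f : Γ → ℕ) (hf : f 1 = 0)
    (hf' : ∀ s ∈ S, ∀ x, f (s * x) ≤ f x + 1 ∧ f (s⁻¹ * x) ≤ f x + 1) (x : Γ) :
    f x ≤ wordLength S x := by
  have key : ∀ u v : Γ, ∀ p : (SimpleGraph.mulCayley S).Walk u v, f (u⁻¹ * v) ≤ p.length := by
    intro u v p
    induction p with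
    | nil => simp [hf]
    | @cons u w v h p ih =>
      have h2 := ((SimpleGraph.mulCayley_adj S u w).1 h).2
      have e : u⁻¹ * v = (u⁻¹ * w) * (w⁻¹ * v) := by group
      have e' : u⁻¹ * v = (w⁻¹ * u)⁻¹ * (w⁻¹ * v) := by group
      rw [SimpleGraph.Walk.length_cons]
      rcases h2 with h2 | h2
      · rw [e]; exact ((hf' _ h2 _).1).trans (by omega)
      · rw [e']; exact ((hf' _ h2 _).2).trans (by omega)
  obtain ⟨p, hp⟩ := (mulCayley_connected hS).exists_walk_length_eq_dist 1 x
  have := key _ _ p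
  rw [hp] at this
  simpa [wordLength] using this

end WordLength

/-! ### Word length in the free product -/

section FreeProduct

open Monoid

variable {r : ℕ} {G : Fin r → Type*} [∀ k, Group (G k)] {S : ∀ k, Set (G k)}

lemma closure_generators (hS : ∀ k, Subgroup.closure (S k) = ⊤) :
    Subgroup.closure (generators S) = ⊤ := by
  rw [eq_top_iff]
  intro x _
  induction x using CoprodI.induction_on with
  | one => exact one_mem _
  | mul x y hx hy => exact mul_mem (hx trivial) (hy trivial)
  | of k g =>
    have hg : (CoprodI.of g : CoprodI G) ∈ (Subgroup.closure (S k)).map CoprodI.of :=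
      Subgroup.mem_map_of_mem _ (hS k ▸ Subgroup.mem_top g)
    rw [MonoidHom.map_closure] at hg
    exact Subgroup.closure_mono (Set.subset_iUnion (fun k => CoprodI.of '' S k) k) hg

/-- The sum of the lengths of the letters of a reduced word, each letter being measured in its own
factor. -/
noncomputable def letterLength (S : ∀ k, Set (G k)) (w : CoprodI.Word G) : ℕ :=
  (w.toList.map fun p => wordLength (S p.1) p.2).sum

lemma wordLength_of_le (hS : ∀ k, Subgroup.closure (S k) = ⊤) {k : Fin r} (g : G k) :
    wordLength (generators S) (CoprodI.of g) ≤ wordLength (S k) g := by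
  have hS' := closure_generators hS
  refine le_wordLength (hS k) (fun g => wordLength (generators S) (CoprodI.of g))
    (by simp [wordLength_one]) (fun s hs x => ?_) g
  have h1 : wordLength (generators S) (CoprodI.of s) ≤ 1 :=
    wordLength_le_one (Set.mem_iUnion.2 ⟨k, s, hs, rfl⟩)
  have h2 := wordLength_inv hS' (CoprodI.of s)
  simp only [map_mul, map_inv]
  exact ⟨(wordLength_mul_le hS' _ _).trans (by omega), (wordLength_mul_le hS' _ _).trans (by omega)⟩

lemma wordLength_prod_le (hS : ∀ k, Subgroup.closure (S k) = ⊤) (w : CoprodI.Word G) :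
    wordLength (generators S) w.prod ≤ letterLength S w := by
  unfold CoprodI.Word.prod letterLength
  induction w.toList with
  | nil => simp [wordLength_one]
  | cons p l ih =>
    simp only [List.map_cons, List.prod_cons, List.sum_cons]
    have h1 := wordLength_of_le hS p.2
    exact (wordLength_mul_le (closure_generators hS) _ _).trans (by omega)

section Decidable

variable [∀ k, DecidableEq (G k)]

lemma letterLength_rcons {k : Fin r} (p : CoprodI.Word.Pair G k) :
    letterLength S (CoprodI.Word.rcons p) = wordLength (S k) p.head + letterLength S p.tail := by
  unfold CoprodI.Word.rcons letterLength
  split_ifs with h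
  · simp [h, wordLength_one]
  · simp

lemma letterLength_of_smul_le (hS : ∀ k, Subgroup.closure (S k) = ⊤) {k : Fin r} (g : G k)
    (w : CoprodI.Word G) :
    letterLength S ((CoprodI.of g : CoprodI G) • w) ≤ wordLength (S k) g + letterLength S w := by
  have h : letterLength S w = wordLength (S k) (CoprodI.Word.equivPair k w).head
      + letterLength S (CoprodI.Word.equivPair k w).tail := by
    rw [← letterLength_rcons, ← CoprodI.Word.equivPair_symm, Equiv.symm_apply_apply]
  rw [CoprodI.Word.of_smul_def, letterLength_rcons, h]
  have := wordLength_mul_le (hS k) g (CoprodI.Word.equivPair k w).head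
  simp only
  omega

end Decidable

/-- The word length of a free product is additive over the letters of a reduced word. -/
lemma wordLength_prod (hS : ∀ k, Subgroup.closure (S k) = ⊤) (w : CoprodI.Word G) :
    wordLength (generators S) w.prod = letterLength S w := by
  classical
  refine le_antisymm (wordLength_prod_le hS w) ?_
  have h := le_wordLength (closure_generators hS)
    (fun x => letterLength S (CoprodI.Word.equiv x)) (by simp [letterLength, CoprodI.Word.equiv])
    (fun s hs x => ?_) w.prod
  · rwa [show CoprodI.Word.equiv w.prod = w from CoprodI.Word.equiv.apply_symm_apply w] at h
  · obtain ⟨k, g, hg, rfl⟩ := Set.mem_iUnion.1 hs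
    have e : ∀ y : CoprodI G, CoprodI.Word.equiv (y * x) = y • CoprodI.Word.equiv x :=
      fun y => mul_smul y x _
    have h1 := wordLength_le_one hg
    have h2 := wordLength_inv (hS k) g
    simp only [e, ← map_inv]
    exact ⟨(letterLength_of_smul_le hS _ _).trans (by omega),
      (letterLength_of_smul_le hS _ _).trans (by omega)⟩

lemma letterLength_append {u v w : CoprodI.Word G} (h : w.toList = u.toList ++ v.toList) :
    letterLength S w = letterLength S u + letterLength S v := by
  simp [letterLength, h]

/-- Reduced words whose concatenation is reduced have additive word length. -/
lemma wordLength_prod_mul_prod (hS : ∀ k, Subgroup.closure (S k) = ⊤) (u v : CoprodI.Word G)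
    (h : ∀ p ∈ u.toList.getLast?, ∀ q ∈ v.toList.head?, p.1 ≠ q.1) :
    wordLength (generators S) (u.prod * v.prod)
      = wordLength (generators S) u.prod + wordLength (generators S) v.prod := by
  let w : CoprodI.Word G :=
    { toList := u.toList ++ v.toList
      ne_one := by
        intro l hl
        rcases List.mem_append.1 hl with hl | hl
        exacts [u.ne_one l hl, v.ne_one l hl]
      chain_ne := List.isChain_append.2 ⟨u.chain_ne, v.chain_ne, h⟩ }
  have hw : w.prod = u.prod * v.prod := by simp [CoprodI.Word.prod, w]
  rw [← hw, wordLength_prod hS, wordLength_prod hS, wordLength_prod hS]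
  exact letterLength_append rfl

/-- Nontrivial elements `a`, `b` of two different factors separate any two elements: one of `u v`,
`u a v`, `u b v` is at least as long as `u` and `v` together. -/
lemma exists_separator (hS : ∀ k, Subgroup.closure (S k) = ⊤) {i j : Fin r} (hij : i ≠ j)
    {a : G i} (ha : a ≠ 1) {b : G j} (hb : b ≠ 1) (x y : CoprodI G) :
    wordLength (generators S) x + wordLength (generators S) y
        ≤ wordLength (generators S) (x * y) ∨
      wordLength (generators S) x + wordLength (generators S) y
        ≤ wordLength (generators S) (x * CoprodI.of a * y) ∨
      wordLength (generators S) x + wordLength (generators S) y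
        ≤ wordLength (generators S) (x * CoprodI.of b * y) := by
  classical
  obtain ⟨u, rfl⟩ := CoprodI.Word.equiv.symm.surjective x
  obtain ⟨v, rfl⟩ := CoprodI.Word.equiv.symm.surjective y
  change wordLength _ u.prod + wordLength _ v.prod ≤ wordLength _ (u.prod * v.prod) ∨
    wordLength _ u.prod + wordLength _ v.prod ≤ wordLength _ (u.prod * CoprodI.of a * v.prod) ∨
    wordLength _ u.prod + wordLength _ v.prod ≤ wordLength _ (u.prod * CoprodI.of b * v.prod)
  by_cases h : ∀ p ∈ u.toList.getLast?, ∀ q ∈ v.toList.head?, p.1 ≠ q.1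
  · exact Or.inl (wordLength_prod_mul_prod hS u v h).ge
  right
  push Not at h
  obtain ⟨p, hp, q, hq, hpq⟩ := h
  have sep : ∀ (k : Fin r) (g : G k), g ≠ 1 → p.1 ≠ k →
      wordLength (generators S) u.prod + wordLength (generators S) v.prod
        ≤ wordLength (generators S) (u.prod * CoprodI.of g * v.prod) := by
    intro k g hg hk
    have hv : v.fstIdx ≠ some k := by
      rw [CoprodI.Word.fstIdx_ne_iff]
      intro l hl hkl
      rw [Option.mem_def] at hq hl
      rw [hq] at hl
      exact hk (hpq.trans (by rw [Option.some.inj hl, hkl]))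
    have h1 : wordLength (generators S) (u.prod * (CoprodI.Word.cons g v hv hg).prod)
        = _ := wordLength_prod_mul_prod hS u (CoprodI.Word.cons g v hv hg) (by
      intro p' hp' q' hq'
      rw [Option.mem_def] at hp hp' hq'
      rw [hp] at hp'
      rw [← Option.some.inj hp']
      simp only [CoprodI.Word.cons, List.head?_cons, Option.some.injEq] at hq'
      rw [← hq']
      exact hk)
    rw [CoprodI.Word.prod_cons, ← mul_assoc] at h1
    have h2 : wordLength (generators S) (CoprodI.of g * v.prod)
        = wordLength (S k) g + wordLength (generators S) v.prod := by
      rw [← CoprodI.Word.prod_cons k g v hg hv, wordLength_prod hS, wordLength_prod hS]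
      simp [letterLength, CoprodI.Word.cons]
    omega
  by_cases hi : p.1 = i
  · exact Or.inr (sep j b hb (by rw [hi]; exact hij))
  · exact Or.inl (sep i a ha hi)

lemma countable_coprodI [∀ k, Finite (G k)] : Countable (CoprodI G) := by
  classical
  have : Function.Injective (fun x : CoprodI G => (CoprodI.Word.equiv x).toList) :=
    fun x y h => CoprodI.Word.equiv.injective (CoprodI.Word.ext h)
  exact this.countable

end FreeProduct

/-! ### The law of the random walk -/

section Support

variable {Γ : Type*} [Group Γ]

lemma walkLaw_mem_subgroup (μ : PMF Γ) (H : Subgroup Γ) (hH : ∀ g, μ g ≠ 0 → g ∈ H) (n : ℕ) :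
    ∀ x, walkLaw μ n x ≠ 0 → x ∈ H := by
  induction n with
  | zero =>
    intro x hx
    have : x = 1 := by simpa [walkLaw, PMF.pure_apply] using hx
    exact this ▸ H.one_mem
  | succ n ih =>
    intro x hx
    rw [walkLaw, ← PMF.mem_support_iff, PMF.mem_support_bind_iff] at hx
    obtain ⟨y, hy, hx⟩ := hx
    rw [PMF.mem_support_map_iff] at hx
    obtain ⟨g, hg, rfl⟩ := hx
    exact H.mul_mem (ih y hy) (hH g hg)

lemma walkLaw_wordLength_le {S : Set Γ} (hS : Subgroup.closure S = ⊤) (μ : PMF Γ) {M : ℕ}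
    (hM : ∀ g, μ g ≠ 0 → wordLength S g ≤ M) (n : ℕ) :
    ∀ x, walkLaw μ n x ≠ 0 → wordLength S x ≤ M * n := by
  induction n with
  | zero =>
    intro x hx
    have : x = 1 := by simpa [walkLaw, PMF.pure_apply] using hx
    simp [this, wordLength_one]
  | succ n ih =>
    intro x hx
    rw [walkLaw, ← PMF.mem_support_iff, PMF.mem_support_bind_iff] at hx
    obtain ⟨y, hy, hx⟩ := hx
    rw [PMF.mem_support_map_iff] at hx
    obtain ⟨g, hg, rfl⟩ := hx
    have h1 := ih y hy
    have h2 := hM g hg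
    have h3 := wordLength_mul_le hS y g
    rw [mul_add, mul_one]
    omega

lemma walkLaw_one (μ : PMF Γ) : walkLaw μ 1 = μ := by
  rw [walkLaw, walkLaw, PMF.pure_bind]
  simp_rw [one_mul]
  exact PMF.map_id μ

end Support

lemma measure_eq_lintegral_indicator {Γ : Type*} [MeasurableSpace Γ]
    [DiscreteMeasurableSpace Γ] (ν : Measure Γ) (s : Set Γ) :
    ν s = ∫⁻ x, s.indicator 1 x ∂ν := by
  rw [lintegral_indicator_one (MeasurableSet.of_discrete)]

lemma lintegral_map_toMeasure {Γ Γ' : Type*} [MeasurableSpace Γ]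
    [DiscreteMeasurableSpace Γ] [MeasurableSpace Γ']
    [DiscreteMeasurableSpace Γ'] (p : PMF Γ) (h : Γ → Γ') (f : Γ' → ENNReal) :
    ∫⁻ x, f x ∂(p.map h).toMeasure = ∫⁻ a, f (h a) ∂p.toMeasure := by
  rw [← PMF.toMeasure_map (p := p) h Measurable.of_discrete,
    lintegral_map Measurable.of_discrete Measurable.of_discrete]

section Walk

variable {Γ : Type*} [Countable Γ] [MeasurableSpace Γ] [DiscreteMeasurableSpace Γ]

open scoped ENNReal

lemma lintegral_toMeasure (p : PMF Γ) (f : Γ → ℝ≥0∞) :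
    ∫⁻ x, f x ∂p.toMeasure = ∑' x, p x * f x := by
  rw [lintegral_countable']
  refine tsum_congr fun x => ?_
  rw [p.toMeasure_apply_singleton x (measurableSet_singleton x), mul_comm]

lemma mul_le_lintegral_toMeasure (p : PMF Γ) (f : Γ → ℝ≥0∞) (a : Γ) :
    p a * f a ≤ ∫⁻ x, f x ∂p.toMeasure := by
  rw [lintegral_toMeasure]
  exact ENNReal.le_tsum a

lemma lintegral_bind_toMeasure {Γ' : Type*} [Countable Γ'] [MeasurableSpace Γ']
    [DiscreteMeasurableSpace Γ'] (p : PMF Γ) (q : Γ → PMF Γ') (f : Γ' → ℝ≥0∞) :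
    ∫⁻ x, f x ∂(p.bind q).toMeasure = ∫⁻ a, ∫⁻ x, f x ∂(q a).toMeasure ∂p.toMeasure := by
  simp_rw [lintegral_toMeasure, PMF.bind_apply, ← ENNReal.tsum_mul_right, ← ENNReal.tsum_mul_left]
  rw [ENNReal.tsum_comm]
  simp_rw [mul_assoc]

lemma ae_toMeasure_iff (p : PMF Γ) (Q : Γ → Prop) :
    (∀ᵐ x ∂p.toMeasure, Q x) ↔ ∀ x, p x ≠ 0 → Q x := by
  rw [ae_iff_of_countable]
  refine forall_congr' fun x => ?_
  rw [p.toMeasure_apply_singleton x (measurableSet_singleton x)]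

variable [Group Γ]

lemma lintegral_walkLaw_zero (μ : PMF Γ) (f : Γ → ℝ≥0∞) :
    ∫⁻ x, f x ∂(walkLaw μ 0).toMeasure = f 1 := by
  rw [walkLaw, PMF.toMeasure_pure, lintegral_dirac]

lemma lintegral_walkLaw_succ (μ : PMF Γ) (n : ℕ) (f : Γ → ℝ≥0∞) :
    ∫⁻ x, f x ∂(walkLaw μ (n + 1)).toMeasure
      = ∫⁻ x, ∫⁻ g, f (x * g) ∂μ.toMeasure ∂(walkLaw μ n).toMeasure := by
  rw [walkLaw, lintegral_bind_toMeasure]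
  simp_rw [lintegral_map_toMeasure]

/-- The Markov property of the walk at time `n`. -/
lemma lintegral_walkLaw_add (μ : PMF Γ) (n m : ℕ) (f : Γ → ℝ≥0∞) :
    ∫⁻ x, f x ∂(walkLaw μ (n + m)).toMeasure
      = ∫⁻ x, ∫⁻ y, f (x * y) ∂(walkLaw μ m).toMeasure ∂(walkLaw μ n).toMeasure := by
  induction m generalizing f with
  | zero => simp_rw [lintegral_walkLaw_zero]; simp
  | succ m ih =>
    rw [← add_assoc, lintegral_walkLaw_succ, ih]
    simp_rw [lintegral_walkLaw_succ, mul_assoc]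

/-- First-step decomposition of the walk. -/
lemma lintegral_walkLaw_succ' (μ : PMF Γ) (n : ℕ) (f : Γ → ℝ≥0∞) :
    ∫⁻ x, f x ∂(walkLaw μ (n + 1)).toMeasure
      = ∫⁻ g, ∫⁻ x, f (g * x) ∂(walkLaw μ n).toMeasure ∂μ.toMeasure := by
  rw [add_comm, lintegral_walkLaw_add, walkLaw_one]

lemma walkLaw_add_apply (μ : PMF Γ) (n m : ℕ) (s : Set Γ) :
    (walkLaw μ (n + m)).toMeasure s
      = ∫⁻ x, (walkLaw μ m).toMeasure {y | x * y ∈ s} ∂(walkLaw μ n).toMeasure := by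
  rw [measure_eq_lintegral_indicator, lintegral_walkLaw_add]
  refine lintegral_congr fun x => ?_
  rw [measure_eq_lintegral_indicator]
  rfl

variable {S : Set Γ}

/-! ### Almost additive lengths -/

/-- The increments of the walk are almost additive in length: started anywhere, the walk has, up to
the factor `c` and the shift `K`, at least the same chance of gaining length `y` as when it is
started at the identity. -/
def AlmostAdditive (S : Set Γ) (μ : PMF Γ) (c : ℝ≥0∞) (K : ℕ) : Prop :=
  ∀ (g : Γ) (m : ℕ) (y : ℝ),
    c * (walkLaw μ m).toMeasure {x | y + K ≤ wordLength S x}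
      ≤ (walkLaw μ m).toMeasure {x | wordLength S g + y ≤ wordLength S (g * x)}

/-- One more step changes the length by at most `M`. -/
lemma walkLaw_succ_tail_le (hS : Subgroup.closure S = ⊤) (μ : PMF Γ) {M : ℕ}
    (hM : ∀ g, μ g ≠ 0 → wordLength S g ≤ M) (n : ℕ) (g : Γ) (z : ℝ) :
    (walkLaw μ (n + 1)).toMeasure {x | z ≤ wordLength S (g * x)}
      ≤ (walkLaw μ n).toMeasure {x | z - M ≤ wordLength S (g * x)} := by
  rw [walkLaw_add_apply, walkLaw_one,
    measure_eq_lintegral_indicator _ {x | z - M ≤ wordLength S (g * x)}]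
  refine lintegral_mono fun x => ?_
  by_cases hx : z - M ≤ wordLength S (g * x)
  · rw [Set.indicator_of_mem (by exact hx)]
    exact prob_le_one
  · rw [Set.indicator_of_notMem (by exact hx), nonpos_iff_eq_zero]
    have : ∀ᵐ y ∂μ.toMeasure, ¬ (z ≤ wordLength S (g * (x * y))) := by
      rw [ae_toMeasure_iff]
      intro y hy h
      have h1 := wordLength_mul_le hS (g * x) y
      have h2 := hM y hy
      have h3 : (wordLength S (g * (x * y)) : ℝ) ≤ wordLength S (g * x) + M := by
        rw [← mul_assoc]; exact_mod_cast h1.trans (by omega)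
      exact hx (by linarith)
    rw [ae_iff] at this
    simpa using this

lemma mul_walkLaw_le_walkLaw_succ (μ : PMF Γ) (n : ℕ) (a : Γ) (s : Set Γ) :
    μ a * (walkLaw μ n).toMeasure {x | a * x ∈ s} ≤ (walkLaw μ (n + 1)).toMeasure s := by
  rw [add_comm n 1, walkLaw_add_apply, walkLaw_one]
  exact mul_le_lintegral_toMeasure μ (fun a => (walkLaw μ n).toMeasure {x | a * x ∈ s}) a

/-- If two possible steps separate any two elements, then lengths are almost additive. -/
lemma almostAdditive_of_separator (hS : Subgroup.closure S = ⊤) (μ : PMF Γ) {M : ℕ}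
    (hM : ∀ g, μ g ≠ 0 → wordLength S g ≤ M) {a b : Γ} (ha : μ a ≠ 0) (hb : μ b ≠ 0)
    (h : ∀ x y, wordLength S x + wordLength S y ≤ wordLength S (x * y) ∨
      wordLength S x + wordLength S y ≤ wordLength S (x * a * y) ∨
      wordLength S x + wordLength S y ≤ wordLength S (x * b * y)) :
    ∃ c : ℝ≥0∞, c ≠ 0 ∧ c ≤ 1 ∧ AlmostAdditive S μ c M := by
  set D : ℝ≥0∞ := 1 + (μ a)⁻¹ + (μ b)⁻¹ with hD
  have hD_top : D ≠ ⊤ := by simp [hD, ha, hb]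
  have hD_one : 1 ≤ D := by rw [hD, add_assoc]; exact le_self_add
  have hD0 : D ≠ 0 := (zero_lt_one.trans_le hD_one).ne'
  refine ⟨D⁻¹, ENNReal.inv_ne_zero.2 hD_top, ENNReal.inv_le_one.2 hD_one, fun g m y => ?_⟩
  rw [ENNReal.inv_mul_le_iff hD0 hD_top]
  set T : ℝ≥0∞ := (walkLaw μ m).toMeasure {x | wordLength S g + y ≤ wordLength S (g * x)}
  set s : Set Γ := {x | (wordLength S g : ℝ) + y + M ≤ wordLength S (g * x)} with hs
  have h1 : (walkLaw μ (m + 1)).toMeasure s ≤ T := by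
    refine (walkLaw_succ_tail_le hS μ hM m g _).trans (measure_mono fun x hx => ?_)
    simpa using hx
  have h0 : (walkLaw μ m).toMeasure s ≤ T := by
    refine measure_mono fun x hx => ?_
    have : (0 : ℝ) ≤ M := Nat.cast_nonneg M
    simp only [hs, Set.mem_ofPred_eq] at hx ⊢
    linarith
  have hstep : ∀ e : Γ, μ e ≠ 0 →
      (walkLaw μ m).toMeasure {x | e * x ∈ s} ≤ (μ e)⁻¹ * T := by
    intro e he
    rw [← ENNReal.inv_mul_le_iff (ENNReal.inv_ne_zero.2 (PMF.apply_ne_top μ e))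
      (ENNReal.inv_ne_top.2 he), inv_inv]
    exact (mul_walkLaw_le_walkLaw_succ μ m e s).trans h1
  have hsub : {x | y + M ≤ wordLength S x} ⊆ s ∪ {x | a * x ∈ s} ∪ {x | b * x ∈ s} := by
    intro x hx
    simp only [hs, Set.mem_ofPred_eq, Set.mem_union, ← mul_assoc] at hx ⊢
    rcases h g x with h | h | h
    · have h' : (wordLength S g : ℝ) + wordLength S x ≤ wordLength S (g * x) := by exact_mod_cast h
      exact Or.inl (Or.inl (by linarith))
    · have h' : (wordLength S g : ℝ) + wordLength S x ≤ wordLength S (g * a * x) := by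
        exact_mod_cast h
      exact Or.inl (Or.inr (by linarith))
    · have h' : (wordLength S g : ℝ) + wordLength S x ≤ wordLength S (g * b * x) := by
        exact_mod_cast h
      exact Or.inr (by linarith)
  calc (walkLaw μ m).toMeasure {x | y + M ≤ wordLength S x}
      ≤ (walkLaw μ m).toMeasure s + (walkLaw μ m).toMeasure {x | a * x ∈ s}
          + (walkLaw μ m).toMeasure {x | b * x ∈ s} :=
        (measure_mono hsub).trans ((measure_union_le _ _).trans
          (add_le_add (measure_union_le _ _) le_rfl))
    _ ≤ T + (μ a)⁻¹ * T + (μ b)⁻¹ * T := by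
        gcongr
        exacts [hstep a ha, hstep b hb]
    _ = D * T := by rw [hD]; ring

/-- If the walk stays bounded, then lengths are trivially almost additive. -/
lemma almostAdditive_of_bounded (hS : Subgroup.closure S = ⊤) (μ : PMF Γ) {M : ℕ}
    (hM : ∀ n x, walkLaw μ n x ≠ 0 → wordLength S x ≤ M) :
    AlmostAdditive S μ 1 (2 * M) := by
  intro g m y
  rw [one_mul]
  refine measure_mono_ae ?_
  change ∀ᵐ x ∂(walkLaw μ m).toMeasure, y + (2 * M : ℕ) ≤ wordLength S x →
    wordLength S g + y ≤ wordLength S (g * x)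
  rw [ae_toMeasure_iff]
  intro x hx h
  have h1 : (wordLength S x : ℝ) ≤ M := by exact_mod_cast hM m x hx
  have h2 : (wordLength S g : ℝ) ≤ wordLength S (g * x) + wordLength S x := by
    exact_mod_cast wordLength_le_mul_right hS g x
  push_cast at h
  linarith

lemma AlmostAdditive.mul_le {μ : PMF Γ} {c : ℝ≥0∞} {K : ℕ} (h : AlmostAdditive S μ c K)
    (n m : ℕ) (x y : ℝ) :
    (c * (walkLaw μ n).toMeasure {z | x + K ≤ wordLength S z})
        * (c * (walkLaw μ m).toMeasure {z | y + K ≤ wordLength S z})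
      ≤ c * (walkLaw μ (n + m)).toMeasure {z | x + y + K ≤ wordLength S z} := by
  rw [mul_assoc]
  gcongr
  rw [walkLaw_add_apply, mul_comm, ← lintegral_indicator_const MeasurableSet.of_discrete]
  refine lintegral_mono fun u => ?_
  by_cases hu : x + K ≤ wordLength S u
  · rw [Set.indicator_of_mem (by exact hu)]
    refine (h u m y).trans (measure_mono fun z hz => ?_)
    simp only [Set.mem_ofPred_eq] at hz ⊢
    linarith
  · rw [Set.indicator_of_notMem (by exact hu)]
    exact zero_le

end Walk

/-! ### Almost additivity in the free product -/

section FreeProduct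

open Monoid

variable {r : ℕ} {G : Fin r → Type*} [∀ k, Group (G k)] {S : ∀ k, Set (G k)}

lemma stepLaw_of_ne_zero {α : PMF (Fin r)} {μ : ∀ k, PMF (G k)} {k : Fin r} (hα : α k ≠ 0)
    {g : G k} (hg : μ k g ≠ 0) : stepLaw α μ (CoprodI.of g) ≠ 0 := by
  rw [stepLaw, ← PMF.mem_support_iff, PMF.mem_support_bind_iff]
  exact ⟨k, hα, (PMF.mem_support_map_iff _ _ _).2 ⟨g, hg, rfl⟩⟩

lemma exists_of_stepLaw_ne_zero {α : PMF (Fin r)} {μ : ∀ k, PMF (G k)} {x : CoprodI G}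
    (hx : stepLaw α μ x ≠ 0) : ∃ k, ∃ g : G k, μ k g ≠ 0 ∧ CoprodI.of g = x := by
  rw [stepLaw, ← PMF.mem_support_iff, PMF.mem_support_bind_iff] at hx
  obtain ⟨k, _, hx⟩ := hx
  obtain ⟨g, hg, rfl⟩ := (PMF.mem_support_map_iff _ _ _).1 hx
  exact ⟨k, g, hg, rfl⟩

lemma exists_stepLaw_wordLength_le [∀ k, Finite (G k)] (S : Set (CoprodI G)) (α : PMF (Fin r))
    (μ : ∀ k, PMF (G k)) :
    ∃ M : ℕ, ∀ x, stepLaw α μ x ≠ 0 → wordLength S x ≤ M := by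
  have : (Set.range fun p : Σ k, G k => wordLength S (CoprodI.of p.2)).Finite := Set.finite_range _
  obtain ⟨M, hM⟩ := this.bddAbove
  refine ⟨M, fun x hx => ?_⟩
  obtain ⟨k, g, _, rfl⟩ := exists_of_stepLaw_ne_zero hx
  exact hM ⟨⟨k, g⟩, rfl⟩

lemma exists_almostAdditive [∀ k, Finite (G k)] [MeasurableSpace (CoprodI G)]
    [DiscreteMeasurableSpace (CoprodI G)] (hS : ∀ k, Subgroup.closure (S k) = ⊤)
    (α : PMF (Fin r)) (hα : ∀ k, 0 < α k) (μ : ∀ k, PMF (G k)) :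
    ∃ c : ENNReal, c ≠ 0 ∧ c ≤ 1 ∧ ∃ K, AlmostAdditive (generators S) (stepLaw α μ) c K := by
  have := countable_coprodI (G := G)
  have hS' := closure_generators hS
  by_cases h : ∃ i j : Fin r, i ≠ j ∧ (∃ a, μ i a ≠ 0 ∧ a ≠ 1) ∧ ∃ b, μ j b ≠ 0 ∧ b ≠ 1
  · obtain ⟨i, j, hij, ⟨a, ha, ha1⟩, b, hb, hb1⟩ := h
    obtain ⟨M, hM⟩ := exists_stepLaw_wordLength_le (generators S) α μ
    obtain ⟨c, hc, hc', h⟩ := almostAdditive_of_separator hS' (stepLaw α μ) hM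
      (stepLaw_of_ne_zero (hα i).ne' ha) (stepLaw_of_ne_zero (hα j).ne' hb)
      (exists_separator hS hij ha1 hb1)
    exact ⟨c, hc, hc', _, h⟩
  · -- All nontrivial steps lie in one factor, so the walk stays in a finite subgroup.
    obtain ⟨k₀, hk₀⟩ : ∃ k₀ : Fin r, ∀ k, k ≠ k₀ → ∀ g, μ k g ≠ 0 → g = 1 := by
      by_cases h' : ∃ i, ∃ a, μ i a ≠ 0 ∧ a ≠ 1
      · obtain ⟨i, a, ha⟩ := h'
        refine ⟨i, fun k hk g hg => ?_⟩
        by_contra hg1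
        exact h ⟨i, k, hk.symm, ⟨a, ha⟩, g, hg, hg1⟩
      · obtain ⟨k₀, _⟩ := α.support_nonempty
        push Not at h'
        exact ⟨k₀, fun k _ g hg => h' k g hg⟩
    have hmem : ∀ n x, walkLaw (stepLaw α μ) n x ≠ 0 →
        x ∈ (CoprodI.of : G k₀ →* CoprodI G).range := by
      refine fun n => walkLaw_mem_subgroup _ _ (fun x hx => ?_) n
      obtain ⟨k, g, hg, rfl⟩ := exists_of_stepLaw_ne_zero hx
      by_cases hk : k = k₀
      · subst hk; exact ⟨g, rfl⟩
      · rw [hk₀ k hk g hg, map_one]; exact one_mem _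
    obtain ⟨M, hM⟩ := (Set.finite_range
      fun g : G k₀ => wordLength (generators S) (CoprodI.of g)).bddAbove
    refine ⟨1, one_ne_zero, le_rfl, _, almostAdditive_of_bounded hS' _ (M := M) fun n x hx => ?_⟩
    obtain ⟨g, rfl⟩ := hmem n x hx
    exact hM ⟨g, rfl⟩

end FreeProduct

/-! ### The rate function and the speed -/

section Rate

variable {Γ : Type*} [Group Γ] [MeasurableSpace Γ] {S : Set Γ} {μ : PMF Γ}

lemma rateFunction_le_iff {x a : ℝ} :
    rateFunction S μ x ≤ (a : EReal) ↔ ∀ t, x * t - limLogMGF S μ t ≤ a := by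
  simp only [rateFunction, iSup_le_iff, EReal.coe_le_coe_iff]

lemma rateFunction_nonneg (h0 : limLogMGF S μ 0 = 0) (x : ℝ) : 0 ≤ rateFunction S μ x := by
  refine le_iSup_of_le (0 : ℝ) ?_
  simp [h0]

lemma rateFunction_drift (h0 : limLogMGF S μ 0 = 0)
    (h1 : ∀ t, t * drift S μ ≤ limLogMGF S μ t) : rateFunction S μ (drift S μ) = 0 := by
  refine le_antisymm ?_ (rateFunction_nonneg h0 _)
  rw [← EReal.coe_zero, rateFunction_le_iff]
  intro t
  linarith [h1 t, mul_comm t (drift S μ)]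

lemma rateFunction_mono (h0 : limLogMGF S μ 0 = 0)
    (h1 : ∀ t, t * drift S μ ≤ limLogMGF S μ t) {x y : ℝ} (hx : drift S μ ≤ x) (hxy : x ≤ y) :
    rateFunction S μ x ≤ rateFunction S μ y := by
  refine iSup_le fun t => ?_
  rcases le_or_gt 0 t with ht | ht
  · refine le_iSup_of_le t (EReal.coe_le_coe_iff.2 ?_)
    nlinarith
  · refine le_trans ?_ (rateFunction_nonneg h0 y)
    rw [← EReal.coe_zero, EReal.coe_le_coe_iff]
    nlinarith [h1 t]

lemma rateFunction_convex {x y a b s : ℝ} (hx : rateFunction S μ x ≤ (a : EReal))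
    (hy : rateFunction S μ y ≤ (b : EReal)) (hs0 : 0 ≤ s) (hs1 : s ≤ 1) :
    rateFunction S μ ((1 - s) * x + s * y) ≤ (((1 - s) * a + s * b : ℝ) : EReal) := by
  rw [rateFunction_le_iff] at *
  intro t
  nlinarith [mul_le_mul_of_nonneg_left (hx t) (sub_nonneg.2 hs1),
    mul_le_mul_of_nonneg_left (hy t) hs0]

lemma le_of_rateFunction_le {M : ℝ} (h2 : ∀ t, 0 ≤ t → limLogMGF S μ t ≤ M * t) {x a : ℝ}
    (hx : rateFunction S μ x ≤ (a : EReal)) : x ≤ M := by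
  rw [rateFunction_le_iff] at hx
  by_contra h
  push Not at h
  have h3 : 0 < x - M := sub_pos.2 h
  have hpos : 0 ≤ (|a| + 1) / (x - M) := by positivity
  have h4 := hx ((|a| + 1) / (x - M))
  have h5 := h2 _ hpos
  have h6 : (x - M) * ((|a| + 1) / (x - M)) = |a| + 1 := mul_div_cancel₀ _ h3.ne'
  have := le_abs_self a
  nlinarith

lemma rateFunction_le_toReal {x : ℝ} (hx : rateFunction S μ x < ⊤) :
    rateFunction S μ x ≤ ((rateFunction S μ x).toReal : EReal) :=
  EReal.le_coe_toReal hx.ne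

lemma bddAbove_rateDomain {M : ℝ} (h2 : ∀ t, 0 ≤ t → limLogMGF S μ t ≤ M * t) :
    BddAbove (rateDomain S μ) :=
  ⟨M, fun _ hx => le_of_rateFunction_le h2 (rateFunction_le_toReal hx.2)⟩

lemma bddAbove_rateFunction_eq {M : ℝ} (h2 : ∀ t, 0 ≤ t → limLogMGF S μ t ≤ M * t) (a : ℝ) :
    BddAbove {x : ℝ | rateFunction S μ x = (a : EReal)} :=
  ⟨M, fun _ hx => le_of_rateFunction_le h2 (le_of_eq hx)⟩

lemma drift_mem_rateDomain (h0 : limLogMGF S μ 0 = 0)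
    (h1 : ∀ t, t * drift S μ ≤ limLogMGF S μ t) (hd : 0 ≤ drift S μ) :
    drift S μ ∈ rateDomain S μ :=
  ⟨hd, by rw [rateFunction_drift h0 h1]; exact EReal.zero_lt_top⟩

lemma drift_le_vMax (h0 : limLogMGF S μ 0 = 0) (h1 : ∀ t, t * drift S μ ≤ limLogMGF S μ t)
    {M : ℝ} (h2 : ∀ t, 0 ≤ t → limLogMGF S μ t ≤ M * t) (hd : 0 ≤ drift S μ) (ρ : ℝ) :
    drift S μ ≤ vMax S μ ρ := by
  unfold vMax
  split_ifs with h
  · obtain ⟨y, hy, hyρ⟩ := h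
    exact (Set.mem_Ici.1 hy).trans (le_csSup (bddAbove_rateFunction_eq h2 _) hyρ)
  · exact le_csSup (bddAbove_rateDomain h2) (drift_mem_rateDomain h0 h1 hd)

/-- Beyond the speed `vMax`, the rate function exceeds `log ρ`, already through nonnegative
parameters. -/
lemma exists_lt_of_vMax_lt (h0 : limLogMGF S μ 0 = 0)
    (h1 : ∀ t, t * drift S μ ≤ limLogMGF S μ t)
    {M : ℝ} (h2 : ∀ t, 0 ≤ t → limLogMGF S μ t ≤ M * t) (hd : 0 ≤ drift S μ) {ρ : ℝ}
    (hρ : 1 < ρ) {x : ℝ} (hx : vMax S μ ρ < x) :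
    ∃ t, 0 ≤ t ∧ Real.log ρ < x * t - limLogMGF S μ t := by
  have hlog := Real.log_pos hρ
  have hdx : drift S μ < x := (drift_le_vMax h0 h1 h2 hd ρ).trans_lt hx
  have hI : (Real.log ρ : EReal) < rateFunction S μ x := by
    unfold vMax at hx
    split_ifs at hx with h
    · obtain ⟨y, hy, hyρ⟩ := h
      have hbdd := bddAbove_rateFunction_eq h2 (Real.log ρ)
      have hyx : y ≤ x := (le_csSup hbdd hyρ).trans hx.le
      refine lt_of_le_of_ne (hyρ ▸ rateFunction_mono h0 h1 hy hyx) fun h => ?_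
      exact hx.not_ge (le_csSup hbdd h.symm)
    · by_contra hlt
      refine hx.not_ge (le_csSup (bddAbove_rateDomain h2) ⟨hd.trans hdx.le, ?_⟩)
      exact (not_lt.1 hlt).trans_lt (EReal.coe_lt_top _)
  obtain ⟨t, ht⟩ := lt_iSup_iff.1 hI
  rw [EReal.coe_lt_coe_iff] at ht
  refine ⟨t, ?_, ht⟩
  by_contra hneg
  push Not at hneg
  nlinarith [h1 t]

/-- Below the speed `vMax`, there are larger points at which the rate function is less than
`log ρ`. This uses that the rate function is convex and lower semicontinuous, hence continuous where
it is finite to the right of the drift. -/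
lemma exists_rateFunction_lt (h0 : limLogMGF S μ 0 = 0)
    (h1 : ∀ t, t * drift S μ ≤ limLogMGF S μ t) (hd : 0 ≤ drift S μ) {ρ : ℝ}
    (hρ : 1 < ρ) {v : ℝ} (hv : v < vMax S μ ρ) :
    ∃ x a, v < x ∧ a < Real.log ρ ∧ ∀ t, x * t - limLogMGF S μ t ≤ a := by
  have hlog := Real.log_pos hρ
  have hdrift : rateFunction S μ (drift S μ) ≤ ((0 : ℝ) : EReal) := (rateFunction_drift h0 h1).le
  unfold vMax at hv
  split_ifs at hv with h
  · obtain ⟨y, hy, hyρ⟩ := h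
    obtain ⟨y', hy', hvy'⟩ := exists_lt_of_lt_csSup (⟨y, hyρ⟩ : Set.Nonempty _) hv
    obtain ⟨Y, hYρ, hYv, hYd⟩ : ∃ Y, rateFunction S μ Y = (Real.log ρ : EReal) ∧ v < Y ∧
        drift S μ ≤ Y := by
      rcases le_total y y' with h | h
      · exact ⟨y', hy', hvy', le_trans hy h⟩
      · exact ⟨y, hyρ, hvy'.trans_le h, hy⟩
    -- Move slightly from `Y` towards the drift: convexity makes the rate strictly smaller.
    obtain ⟨s, hs0, hs1, hsv⟩ : ∃ s : ℝ, 0 < s ∧ s ≤ 1 ∧ v < Y - s * (Y - drift S μ) := by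
      refine ⟨min 1 ((Y - v) / (2 * (Y - drift S μ + 1))), ?_, min_le_left _ _, ?_⟩
      · exact lt_min one_pos (div_pos (by linarith) (by linarith))
      · have h3 : min 1 ((Y - v) / (2 * (Y - drift S μ + 1))) * (Y - drift S μ)
            ≤ (Y - v) / (2 * (Y - drift S μ + 1)) * (Y - drift S μ + 1) :=
          mul_le_mul (min_le_right _ _) (by linarith) (by linarith)
            (div_pos (by linarith) (by linarith)).le
        have h4 : (Y - v) / (2 * (Y - drift S μ + 1)) * (Y - drift S μ + 1) = (Y - v) / 2 := by
          have : Y - drift S μ + 1 ≠ 0 := by linarith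
          field_simp
        linarith
    refine ⟨(1 - s) * Y + s * drift S μ, (1 - s) * Real.log ρ + s * 0, by linarith, by nlinarith,
      rateFunction_le_iff.1 (rateFunction_convex hYρ.le hdrift hs0.le hs1)⟩
  · obtain ⟨x₀, hx₀, hvx₀⟩ := exists_lt_of_lt_csSup ⟨_, drift_mem_rateDomain h0 h1 hd⟩ hv
    obtain ⟨X, hXtop, hXv, hXd⟩ : ∃ X, rateFunction S μ X < ⊤ ∧ v < X ∧ drift S μ ≤ X := by
      rcases le_total x₀ (drift S μ) with h | h
      · exact ⟨drift S μ, (drift_mem_rateDomain h0 h1 hd).2, hvx₀.trans_le h, le_rfl⟩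
      · exact ⟨x₀, hx₀.2, hvx₀, h⟩
    have hne : ∀ z, drift S μ ≤ z → rateFunction S μ z ≠ (Real.log ρ : EReal) :=
      fun z hz he => h ⟨z, hz, he⟩
    have hreal : ∀ {z}, rateFunction S μ z < ⊤ →
        rateFunction S μ z = ((rateFunction S μ z).toReal : EReal) := fun {z} hz =>
      (EReal.coe_toReal hz.ne
        (EReal.bot_lt_zero.trans_le (rateFunction_nonneg h0 z)).ne').symm
    set b := (rateFunction S μ X).toReal
    have hXb : rateFunction S μ X = (b : EReal) := hreal hXtop
    rcases lt_or_gt_of_ne (hne X hXd) with hlt | hgt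
    · refine ⟨X, b, hXv, ?_, rateFunction_le_iff.1 hXb.le⟩
      rwa [hXb, EReal.coe_lt_coe_iff] at hlt
    -- Otherwise the rate function would take the value `log ρ` at the last point before `X`
    -- where it is at most `log ρ`.
    exfalso
    rw [hXb, EReal.coe_lt_coe_iff] at hgt
    set A : Set ℝ := {z | drift S μ ≤ z ∧ z ≤ X ∧ rateFunction S μ z ≤ (Real.log ρ : EReal)} with hA
    have hAne : A.Nonempty :=
      ⟨drift S μ, le_rfl, hXd, hdrift.trans (EReal.coe_le_coe_iff.2 hlog.le)⟩
    have hAbdd : BddAbove A := ⟨X, fun z hz => hz.2.1⟩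
    set y := sSup A
    have hyd : drift S μ ≤ y := by
      obtain ⟨z, hz⟩ := hAne
      exact hz.1.trans (le_csSup hAbdd hz)
    have hyρ : rateFunction S μ y ≤ (Real.log ρ : EReal) := by
      rw [rateFunction_le_iff]
      intro t
      have hcl : IsClosed {z : ℝ | z * t - limLogMGF S μ t ≤ Real.log ρ} :=
        isClosed_le (by fun_prop) continuous_const
      exact closure_minimal (fun z hz => rateFunction_le_iff.1 hz.2.2 t) hcl
        (csSup_mem_closure hAne hAbdd)
    have hyX : y < X := by
      refine lt_of_le_of_ne (csSup_le hAne fun z hz => hz.2.1) fun he => ?_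
      rw [he, hXb, EReal.coe_le_coe_iff] at hyρ
      exact hgt.not_ge hyρ
    set a := (rateFunction S μ y).toReal
    have hya : rateFunction S μ y = (a : EReal) := hreal (hyρ.trans_lt (EReal.coe_lt_top _))
    have haρ : a < Real.log ρ := by
      have := lt_of_le_of_ne hyρ (hne y hyd)
      rwa [hya, EReal.coe_lt_coe_iff] at this
    set s := (Real.log ρ - a) / (b - a) with hs
    have hba : 0 < b - a := by linarith
    have hs0 : 0 < s := div_pos (by linarith) hba
    have hs1 : s ≤ 1 := (div_le_one hba).2 (by linarith)
    have hsba : s * (b - a) = Real.log ρ - a := div_mul_cancel₀ _ hba.ne'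
    have hz := rateFunction_convex hya.le hXb.le hs0.le hs1
    rw [show (1 - s) * a + s * b = Real.log ρ by linarith] at hz
    have hzA : (1 - s) * y + s * X ∈ A := ⟨by nlinarith, by nlinarith, hz⟩
    have := le_csSup hAbdd hzA
    nlinarith

end Rate

/-! ### Existence of the drift and of the limiting cumulant generating function -/

section Basic

variable {Γ : Type*} [MeasurableSpace Γ] [Group Γ] {S : Set Γ} {μ : PMF Γ}

/-- The moment generating function of the length of the walk at time `n`. -/
noncomputable def lengthMGF (S : Set Γ) (μ : PMF Γ) (n : ℕ) (t : ℝ) : ℝ :=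
  ∫ y, Real.exp (t * wordLength S y) ∂(walkLaw μ n).toMeasure

lemma lengthMGF_nonneg (n : ℕ) (t : ℝ) : 0 ≤ lengthMGF S μ n t :=
  integral_nonneg fun _ => (Real.exp_pos _).le

lemma logMGF_eq (n : ℕ) (t : ℝ) : logMGF S μ n t = Real.log (lengthMGF S μ n t) / n := by
  rw [logMGF, lengthMGF]; ring

lemma integral_wordLength_nonneg (n : ℕ) :
    0 ≤ ∫ y, (wordLength S y : ℝ) ∂(walkLaw μ n).toMeasure :=
  integral_nonneg fun _ => Nat.cast_nonneg _

end Basic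

section Limits

variable {Γ : Type*} [Countable Γ] [MeasurableSpace Γ] [DiscreteMeasurableSpace Γ] [Group Γ]
  {S : Set Γ} {μ : PMF Γ} {M : ℕ}

lemma ae_wordLength_le (hS : Subgroup.closure S = ⊤)
    (hM : ∀ g, μ g ≠ 0 → wordLength S g ≤ M) (n : ℕ) :
    ∀ᵐ x ∂(walkLaw μ n).toMeasure, wordLength S x ≤ M * n :=
  (ae_toMeasure_iff _ _).2 (walkLaw_wordLength_le hS μ hM n)

lemma integrable_wordLength (hS : Subgroup.closure S = ⊤)
    (hM : ∀ g, μ g ≠ 0 → wordLength S g ≤ M) (n : ℕ) (φ : ℕ → ℝ) :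
    Integrable (fun x => φ (wordLength S x)) (walkLaw μ n).toMeasure := by
  refine Integrable.of_bound (Measurable.of_discrete.aestronglyMeasurable)
    (∑ k ∈ Finset.range (M * n + 1), |φ k|) ?_
  filter_upwards [ae_wordLength_le hS hM n] with x hx
  exact Finset.single_le_sum (f := fun k => |φ k|) (fun k _ => abs_nonneg (φ k))
    (Finset.mem_range.2 (by omega))

lemma ofReal_integral_wordLength (hS : Subgroup.closure S = ⊤)
    (hM : ∀ g, μ g ≠ 0 → wordLength S g ≤ M) (n : ℕ) (φ : ℕ → ℝ) (hφ : ∀ k, 0 ≤ φ k) :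
    ENNReal.ofReal (∫ x, φ (wordLength S x) ∂(walkLaw μ n).toMeasure)
      = ∫⁻ x, ENNReal.ofReal (φ (wordLength S x)) ∂(walkLaw μ n).toMeasure :=
  ofReal_integral_eq_lintegral_ofReal (integrable_wordLength hS hM n φ)
    (.of_forall fun _ => hφ _)

lemma ofReal_lengthMGF (hS : Subgroup.closure S = ⊤)
    (hM : ∀ g, μ g ≠ 0 → wordLength S g ≤ M) (n : ℕ) (t : ℝ) :
    ENNReal.ofReal (lengthMGF S μ n t)
      = ∫⁻ x, ENNReal.ofReal (Real.exp (t * wordLength S x)) ∂(walkLaw μ n).toMeasure :=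
  ofReal_integral_wordLength hS hM n (fun k => Real.exp (t * k)) (fun _ => (Real.exp_pos _).le)

lemma exp_le_lengthMGF (hS : Subgroup.closure S = ⊤)
    (hM : ∀ g, μ g ≠ 0 → wordLength S g ≤ M) (n : ℕ) (t : ℝ) :
    Real.exp (t * ∫ y, (wordLength S y : ℝ) ∂(walkLaw μ n).toMeasure) ≤ lengthMGF S μ n t := by
  set m := ∫ y, (wordLength S y : ℝ) ∂(walkLaw μ n).toMeasure with hm
  have hint := integrable_wordLength hS hM n (fun k => (k : ℝ))
  have h : ∫ y, Real.exp (t * m) * (1 + t * ((wordLength S y : ℝ) - m))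
      ∂(walkLaw μ n).toMeasure ≤ lengthMGF S μ n t := by
    refine integral_mono
      (integrable_wordLength hS hM n (fun k => Real.exp (t * m) * (1 + t * ((k : ℝ) - m))))
      (integrable_wordLength hS hM n (fun k => Real.exp (t * k))) fun y => ?_
    have h1 : Real.exp (t * (wordLength S y : ℝ))
        = Real.exp (t * m) * Real.exp (t * ((wordLength S y : ℝ) - m)) := by
      rw [← Real.exp_add]; ring_nf
    simp only [h1]
    refine mul_le_mul_of_nonneg_left ?_ (Real.exp_pos _).le
    linarith [Real.add_one_le_exp (t * ((wordLength S y : ℝ) - m))]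
  refine le_trans (le_of_eq ?_) h
  have hint' : Integrable (fun y => t * ((wordLength S y : ℝ) - m)) (walkLaw μ n).toMeasure :=
    (hint.sub (integrable_const m)).const_mul t
  rw [integral_const_mul, integral_add (integrable_const _) hint', integral_const_mul,
    integral_sub hint (integrable_const m), ← hm]
  simp

lemma lengthMGF_pos (hS : Subgroup.closure S = ⊤)
    (hM : ∀ g, μ g ≠ 0 → wordLength S g ≤ M) (n : ℕ) (t : ℝ) : 0 < lengthMGF S μ n t :=
  (Real.exp_pos _).trans_le (exp_le_lengthMGF hS hM n t)

lemma lengthMGF_le (hS : Subgroup.closure S = ⊤)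
    (hM : ∀ g, μ g ≠ 0 → wordLength S g ≤ M) (n : ℕ) (t : ℝ) :
    lengthMGF S μ n t ≤ Real.exp (|t| * M * n) := by
  have h : lengthMGF S μ n t ≤ ∫ _, Real.exp (|t| * M * n) ∂(walkLaw μ n).toMeasure := by
    refine integral_mono_ae (integrable_wordLength hS hM n (fun k => Real.exp (t * k)))
      (integrable_const _) ?_
    filter_upwards [ae_wordLength_le hS hM n] with x hx
    have hx' : (wordLength S x : ℝ) ≤ M * n := by exact_mod_cast hx
    refine Real.exp_le_exp.2 ?_
    calc t * wordLength S x ≤ |t| * wordLength S x := by gcongr; exact le_abs_self t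
      _ ≤ |t| * (M * n) := by gcongr
      _ = |t| * M * n := by ring
  simpa using h

lemma lengthMGF_mul (hS : Subgroup.closure S = ⊤)
    (hM : ∀ g, μ g ≠ 0 → wordLength S g ≤ M) (n m : ℕ) (t : ℝ) :
    ∫⁻ x, ∫⁻ y, ENNReal.ofReal (Real.exp (t * (wordLength S x + wordLength S y)))
      ∂(walkLaw μ m).toMeasure ∂(walkLaw μ n).toMeasure
      = ENNReal.ofReal (lengthMGF S μ n t * lengthMGF S μ m t) := by
  rw [ENNReal.ofReal_mul (lengthMGF_nonneg n t), ofReal_lengthMGF hS hM, ofReal_lengthMGF hS hM,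
    ← lintegral_mul_const _ Measurable.of_discrete]
  refine lintegral_congr fun x => ?_
  rw [← lintegral_const_mul _ Measurable.of_discrete]
  refine lintegral_congr fun y => ?_
  rw [← ENNReal.ofReal_mul (Real.exp_pos _).le, ← Real.exp_add, mul_add]

lemma lengthMGF_add_le (hS : Subgroup.closure S = ⊤)
    (hM : ∀ g, μ g ≠ 0 → wordLength S g ≤ M) (n m : ℕ) {t : ℝ} (ht : 0 ≤ t) :
    lengthMGF S μ (n + m) t ≤ lengthMGF S μ n t * lengthMGF S μ m t := by
  rw [← ENNReal.ofReal_le_ofReal_iff (mul_nonneg (lengthMGF_nonneg _ _) (lengthMGF_nonneg _ _)),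
    ← lengthMGF_mul hS hM, ofReal_lengthMGF hS hM, lintegral_walkLaw_add]
  refine lintegral_mono fun x => lintegral_mono fun y => ENNReal.ofReal_le_ofReal ?_
  refine Real.exp_le_exp.2 (mul_le_mul_of_nonneg_left ?_ ht)
  exact_mod_cast wordLength_mul_le hS x y

lemma le_lengthMGF_add (hS : Subgroup.closure S = ⊤)
    (hM : ∀ g, μ g ≠ 0 → wordLength S g ≤ M) (n m : ℕ) {t : ℝ} (ht : t ≤ 0) :
    lengthMGF S μ n t * lengthMGF S μ m t ≤ lengthMGF S μ (n + m) t := by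
  rw [← ENNReal.ofReal_le_ofReal_iff (lengthMGF_nonneg _ _),
    ← lengthMGF_mul hS hM, ofReal_lengthMGF hS hM, lintegral_walkLaw_add]
  refine lintegral_mono fun x => lintegral_mono fun y => ENNReal.ofReal_le_ofReal ?_
  refine Real.exp_le_exp.2 (mul_le_mul_of_nonpos_left ?_ ht)
  exact_mod_cast wordLength_mul_le hS x y

lemma log_lengthMGF_le (hS : Subgroup.closure S = ⊤)
    (hM : ∀ g, μ g ≠ 0 → wordLength S g ≤ M) (n : ℕ) (t : ℝ) :
    Real.log (lengthMGF S μ n t) ≤ |t| * M * n := by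
  rw [← Real.log_exp (|t| * M * n)]
  exact Real.log_le_log (lengthMGF_pos hS hM n t) (lengthMGF_le hS hM n t)

lemma le_log_lengthMGF (hS : Subgroup.closure S = ⊤)
    (hM : ∀ g, μ g ≠ 0 → wordLength S g ≤ M) (n : ℕ) (t : ℝ) :
    t * ∫ y, (wordLength S y : ℝ) ∂(walkLaw μ n).toMeasure ≤ Real.log (lengthMGF S μ n t) := by
  rw [Real.le_log_iff_exp_le (lengthMGF_pos hS hM n t)]
  exact exp_le_lengthMGF hS hM n t

lemma integral_wordLength_le (hS : Subgroup.closure S = ⊤)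
    (hM : ∀ g, μ g ≠ 0 → wordLength S g ≤ M) (n : ℕ) :
    ∫ y, (wordLength S y : ℝ) ∂(walkLaw μ n).toMeasure ≤ M * n := by
  have h := (le_log_lengthMGF hS hM n 1).trans (log_lengthMGF_le hS hM n 1)
  simpa using h

/-- The cumulant generating functions converge: by Fekete's lemma, as they are subadditive in time
for `t ≥ 0` and superadditive for `t ≤ 0`. -/
lemma tendsto_logMGF (hS : Subgroup.closure S = ⊤)
    (hM : ∀ g, μ g ≠ 0 → wordLength S g ≤ M) (t : ℝ) :
    Tendsto (fun n => logMGF S μ n t) atTop (𝓝 (limLogMGF S μ t)) := by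
  refine tendsto_nhds_limUnder ?_
  have hpos := fun n => lengthMGF_pos hS hM n t
  have hE0 := fun n => integral_wordLength_nonneg (S := S) (μ := μ) n
  have hE1 := fun n => integral_wordLength_le hS hM n
  have hlow : ∀ n, -(|t| * M * n) ≤ Real.log (lengthMGF S μ n t) := fun n => by
    refine le_trans ?_ (le_log_lengthMGF hS hM n t)
    have h1 := neg_abs_le t
    have h2 := mul_le_mul_of_nonneg_right h1 (hE0 n)
    have h3 := mul_le_mul_of_nonneg_left (hE1 n) (abs_nonneg t)
    nlinarith
  have hupp := fun n => log_lengthMGF_le hS hM n t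
  have hdiv : ∀ (n : ℕ) (y : ℝ), -(|t| * M * n) ≤ y → -(|t| * M) ≤ y / n := by
    intro n y hy
    rcases Nat.eq_zero_or_pos n with rfl | hn
    · simp only [Nat.cast_zero, div_zero, neg_nonpos]; positivity
    · rw [le_div_iff₀ (by exact_mod_cast hn)]; linarith
  rcases le_total 0 t with ht | ht
  · have hsub : Subadditive fun n => Real.log (lengthMGF S μ n t) := fun m n => by
      rw [← Real.log_mul (hpos m).ne' (hpos n).ne']
      exact Real.log_le_log (hpos _) (lengthMGF_add_le hS hM m n ht)
    refine ⟨hsub.lim, (hsub.tendsto_lim ⟨-(|t| * M), ?_⟩).congr fun n => ?_⟩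
    · rintro _ ⟨n, rfl⟩
      exact hdiv n _ (hlow n)
    · rw [logMGF_eq]
  · have hsub : Subadditive fun n => -Real.log (lengthMGF S μ n t) := fun m n => by
      rw [← neg_add, ← Real.log_mul (hpos m).ne' (hpos n).ne', neg_le_neg_iff]
      exact Real.log_le_log (mul_pos (hpos _) (hpos _)) (le_lengthMGF_add hS hM m n ht)
    refine ⟨-hsub.lim, ((hsub.tendsto_lim ⟨-(|t| * M), ?_⟩).neg).congr fun n => ?_⟩
    · rintro _ ⟨n, rfl⟩
      exact hdiv n _ (neg_le_neg (hupp n))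
    · rw [logMGF_eq]; ring

lemma tendsto_drift (hS : Subgroup.closure S = ⊤)
    (hM : ∀ g, μ g ≠ 0 → wordLength S g ≤ M) :
    Tendsto (fun n : ℕ => (∫ y, (wordLength S y : ℝ) ∂(walkLaw μ n).toMeasure) / n) atTop
      (𝓝 (drift S μ)) := by
  refine tendsto_nhds_limUnder ?_
  have hsub : Subadditive fun n => ∫ y, (wordLength S y : ℝ) ∂(walkLaw μ n).toMeasure := fun m n => by
    have hint := fun n => integrable_wordLength hS hM n (fun k => (k : ℝ))
    rw [← ENNReal.ofReal_le_ofReal_iff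
        (add_nonneg (integral_wordLength_nonneg _) (integral_wordLength_nonneg _)),
      ENNReal.ofReal_add (integral_wordLength_nonneg _) (integral_wordLength_nonneg _),
      ofReal_integral_wordLength hS hM _ (fun k => (k : ℝ)) (fun k => Nat.cast_nonneg k),
      ofReal_integral_wordLength hS hM _ (fun k => (k : ℝ)) (fun k => Nat.cast_nonneg k),
      ofReal_integral_wordLength hS hM _ (fun k => (k : ℝ)) (fun k => Nat.cast_nonneg k),
      lintegral_walkLaw_add]
    calc ∫⁻ x, ∫⁻ y, ENNReal.ofReal (wordLength S (x * y)) ∂(walkLaw μ n).toMeasure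
            ∂(walkLaw μ m).toMeasure
        ≤ ∫⁻ x, ∫⁻ y, (ENNReal.ofReal (wordLength S x) + ENNReal.ofReal (wordLength S y))
            ∂(walkLaw μ n).toMeasure ∂(walkLaw μ m).toMeasure := by
          refine lintegral_mono fun x => lintegral_mono fun y => ?_
          rw [← ENNReal.ofReal_add (Nat.cast_nonneg _) (Nat.cast_nonneg _)]
          refine ENNReal.ofReal_le_ofReal ?_
          exact_mod_cast wordLength_mul_le hS x y
      _ = _ := by
          simp_rw [lintegral_add_left Measurable.of_discrete, lintegral_const, measure_univ, mul_one]
  refine ⟨hsub.lim, hsub.tendsto_lim ⟨0, ?_⟩⟩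
  rintro _ ⟨n, rfl⟩
  exact div_nonneg (integral_wordLength_nonneg n) (Nat.cast_nonneg n)

lemma drift_nonneg (hS : Subgroup.closure S = ⊤)
    (hM : ∀ g, μ g ≠ 0 → wordLength S g ≤ M) : 0 ≤ drift S μ :=
  ge_of_tendsto' (tendsto_drift hS hM) fun n =>
    div_nonneg (integral_wordLength_nonneg n) (Nat.cast_nonneg n)

lemma limLogMGF_zero (hS : Subgroup.closure S = ⊤)
    (hM : ∀ g, μ g ≠ 0 → wordLength S g ≤ M) : limLogMGF S μ 0 = 0 := by
  refine tendsto_nhds_unique (tendsto_logMGF hS hM 0) ?_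
  simp [logMGF]

lemma mul_drift_le_limLogMGF (hS : Subgroup.closure S = ⊤)
    (hM : ∀ g, μ g ≠ 0 → wordLength S g ≤ M) (t : ℝ) : t * drift S μ ≤ limLogMGF S μ t := by
  refine le_of_tendsto_of_tendsto' ((tendsto_drift hS hM).const_mul t) (tendsto_logMGF hS hM t)
    fun n => ?_
  have h := div_le_div_of_nonneg_right (le_log_lengthMGF hS hM n t) (Nat.cast_nonneg (α := ℝ) n)
  rw [logMGF_eq, ← mul_div_assoc]
  exact h

lemma limLogMGF_le (hS : Subgroup.closure S = ⊤)
    (hM : ∀ g, μ g ≠ 0 → wordLength S g ≤ M) {t : ℝ} (ht : 0 ≤ t) :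
    limLogMGF S μ t ≤ M * t := by
  refine le_of_tendsto (tendsto_logMGF hS hM t) ?_
  filter_upwards [eventually_gt_atTop 0] with n hn
  have h := log_lengthMGF_le hS hM n t
  rw [abs_of_nonneg ht] at h
  rw [logMGF_eq, div_le_iff₀ (by exact_mod_cast hn)]
  linarith

end Limits

/-! ### Supporting lines of supermultiplicative families -/

section SupportingLine

variable {B : ℕ → ℝ → ℝ}

lemma pow_le_of_supermultiplicative (h0 : ∀ n y, 0 ≤ B n y)
    (hmul : ∀ n m x y, B n x * B m y ≤ B (n + m) (x + y)) (n : ℕ) (y : ℝ) {p : ℕ} (hp : 1 ≤ p) :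
    B n y ^ p ≤ B (p * n) (p * y) := by
  induction p, hp using Nat.le_induction with
  | base => simp
  | succ p hp ih =>
    rw [pow_succ]
    refine (mul_le_mul_of_nonneg_right ih (h0 n y)).trans ((hmul _ _ _ _).trans (le_of_eq ?_))
    congr 1
    · ring
    · push_cast; ring

/-- Supporting lines of a supermultiplicative family: if `B n (n v) ≤ exp (-n a)` for all `n`
at a rational slope `v`, then either the bound extends to an affine one with some slope `-t`, or the
family vanishes beyond `v`. -/
lemma exists_supporting_line (h0 : ∀ n y, 0 ≤ B n y) (hanti : ∀ n, Antitone (B n))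
    (hmul : ∀ n m x y, B n x * B m y ≤ B (n + m) (x + y)) {z : ℤ} {w : ℕ} (hw : 0 < w) {a : ℝ}
    (hB : ∀ n : ℕ, 1 ≤ n → B n (n * (z / w)) ≤ Real.exp (-(n * a))) :
    (∃ t, 0 ≤ t ∧ ∀ n : ℕ, 1 ≤ n → ∀ k : ℤ,
        B n k ≤ Real.exp (-(n * a) - t * (k - n * (z / w)))) ∨
      ∀ n : ℕ, 1 ≤ n → ∀ k : ℤ, (n : ℝ) * (z / w) < k → B n k = 0 := by
  set v : ℝ := z / w with hv
  have hw' : (0 : ℝ) < w := by exact_mod_cast hw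
  have hvw : v * w = z := div_mul_cancel₀ _ hw'.ne'
  by_cases hright : ∀ n : ℕ, 1 ≤ n → ∀ k : ℤ, (n : ℝ) * v < k → B n k = 0
  · exact Or.inr hright
  left
  push Not at hright
  obtain ⟨n₀, hn₀, k₀, hk₀, hB₀⟩ := hright
  -- `F n k` is the excess of the logarithm over the bound at slope `v`.
  set F : ℕ → ℤ → ℝ := fun n k => Real.log (B n k) + n * a with hF
  have hpos : ∀ {n : ℕ} {y : ℝ}, B n y ≠ 0 → 0 < B n y := fun h => lt_of_le_of_ne (h0 _ _) h.symm
  -- Combining a point to the left of `v` with one to the right, in proportions that hit `v`.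
  have hcomb : ∀ {n n' : ℕ} {k k' : ℤ}, 1 ≤ n → B n k ≠ 0 → B n' k' ≠ 0 →
      (n : ℝ) * v < k → (k' : ℝ) < n' * v →
      F n' k' * (k - n * v) ≤ -(F n k) * (n' * v - k') := by
    intro n n' k k' hn hBk hBk' hk hk'
    have hp' : (0 : ℝ) < ((z * n' - k' * w : ℤ) : ℝ) := by
      push_cast; rw [← hvw]; nlinarith
    have hq' : (0 : ℝ) < ((k * w - z * n : ℤ) : ℝ) := by
      push_cast; rw [← hvw]; nlinarith
    obtain ⟨p, hp⟩ := Int.eq_ofNat_of_zero_le (Int.cast_pos.1 hp').le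
    obtain ⟨q, hq⟩ := Int.eq_ofNat_of_zero_le (Int.cast_pos.1 hq').le
    rw [hp] at hp'
    rw [hq] at hq'
    have hp1 : 1 ≤ p := by exact_mod_cast hp'
    have hq1 : 1 ≤ q := by exact_mod_cast hq'
    have hpR : (p : ℝ) = w * (n' * v - k') := by
      have : ((z * n' - k' * w : ℤ) : ℝ) = p := by rw [hp]; rfl
      push_cast at this
      rw [← this, ← hvw]; ring
    have hqR : (q : ℝ) = w * (k - n * v) := by
      have : ((k * w - z * n : ℤ) : ℝ) = q := by rw [hq]; rfl
      push_cast at this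
      rw [← this, ← hvw]; ring
    have hN : 1 ≤ p * n + q * n' := le_add_right (Nat.mul_pos hp1 hn)
    have h1 : B n k ^ p * B n' k' ^ q ≤ Real.exp (-(((p * n + q * n' : ℕ) : ℝ) * a)) := by
      refine le_trans ?_ (hB _ hN)
      refine (mul_le_mul (pow_le_of_supermultiplicative h0 hmul n k hp1)
        (pow_le_of_supermultiplicative h0 hmul n' k' hq1) (pow_nonneg (h0 _ _) _) (h0 _ _)).trans
        ((hmul _ _ _ _).trans (le_of_eq ?_))
      congr 1
      push_cast
      rw [hpR, hqR]; ring
    have h2 := Real.log_le_log (mul_pos (pow_pos (hpos hBk) p) (pow_pos (hpos hBk') q)) h1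
    rw [Real.log_exp, Real.log_mul (pow_pos (hpos hBk) p).ne' (pow_pos (hpos hBk') q).ne',
      Real.log_pow, Real.log_pow] at h2
    push_cast at h2
    have h3 : (p : ℝ) * F n k + q * F n' k' ≤ 0 := by simp only [hF]; nlinarith
    rw [hpR, hqR] at h3
    have h4 : (w : ℝ) * ((n' * v - k') * F n k + (k - n * v) * F n' k') ≤ 0 := by nlinarith
    have h5 := nonpos_of_mul_nonpos_right h4 hw'
    linarith
  have hcenter : ∀ {n : ℕ} {k : ℤ}, 1 ≤ n → B n k ≠ 0 → (n : ℝ) * v ≤ k → F n k ≤ 0 := by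
    intro n k hn hBk hk
    have h1 := Real.log_le_log (hpos hBk) ((hanti n hk).trans (hB n hn))
    rw [Real.log_exp] at h1
    simp only [hF]; linarith
  set L : Set ℝ := insert 0 {s | ∃ (n' : ℕ) (k' : ℤ), B n' k' ≠ 0 ∧ (k' : ℝ) < n' * v ∧
    s = F n' k' / (n' * v - k')} with hL
  have hbound : ∀ {n : ℕ} {k : ℤ}, 1 ≤ n → B n k ≠ 0 → (n : ℝ) * v < k → ∀ s ∈ L,
      s ≤ -(F n k) / (k - n * v) := by
    intro n k hn hBk hk s hs
    rw [le_div_iff₀ (sub_pos.2 hk)]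
    rcases hs with rfl | ⟨n', k', hBk', hk', rfl⟩
    · rw [zero_mul]; linarith [hcenter hn hBk hk.le]
    · rw [div_mul_eq_mul_div, div_le_iff₀ (sub_pos.2 hk')]
      exact hcomb hn hBk hBk' hk hk'
  have hLbdd : BddAbove L := ⟨_, hbound hn₀ hB₀ hk₀⟩
  have hL0 : (0 : ℝ) ∈ L := Set.mem_insert _ _
  refine ⟨sSup L, le_csSup hLbdd hL0, fun n hn k => ?_⟩
  by_cases hBk : B n k = 0
  · rw [hBk]; exact (Real.exp_pos _).le
  rw [← Real.log_le_iff_le_exp (hpos hBk)]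
  suffices h : F n k ≤ -(sSup L * (k - n * v)) by simp only [hF] at h; linarith
  rcases lt_trichotomy ((n : ℝ) * v) k with hk | hk | hk
  · have h1 := csSup_le ⟨0, hL0⟩ (hbound hn hBk hk)
    rw [le_div_iff₀ (sub_pos.2 hk)] at h1
    linarith
  · rw [hk, sub_self, mul_zero, neg_zero]
    exact hcenter hn hBk hk.le
  · have h1 : F n k / (n * v - k) ≤ sSup L :=
      le_csSup hLbdd (Set.mem_insert_of_mem _ ⟨n, k, hBk, hk, rfl⟩)
    rw [div_le_iff₀ (sub_pos.2 hk)] at h1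
    linarith

end SupportingLine

/-! ### The large deviation lower bound -/

section LowerBound

variable {Γ : Type*} [Countable Γ] [MeasurableSpace Γ] [DiscreteMeasurableSpace Γ] [Group Γ]
  {S : Set Γ} {μ : PMF Γ} {M : ℕ}

/-- The tail probability `ℙ(|Yₙ| ≥ y + K)`, scaled by `c` so as to be supermultiplicative. -/
noncomputable def scaledTail (S : Set Γ) (μ : PMF Γ) (c : ENNReal) (K n : ℕ) (y : ℝ) : ENNReal :=
  c * (walkLaw μ n).toMeasure {x | y + K ≤ wordLength S x}

/-- An exponential bound on all tails bounds the limiting cumulant generating function. -/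
lemma limLogMGF_le_of_tail (hS : Subgroup.closure S = ⊤)
    (hM : ∀ g, μ g ≠ 0 → wordLength S g ≤ M) {c : ENNReal} (hc : c ≠ 0) (hc1 : c ≤ 1) {K : ℕ}
    {v a t : ℝ}
    (h : ∀ n : ℕ, 1 ≤ n → ∀ k : ℤ,
      (scaledTail S μ c K n k).toReal ≤ Real.exp (-(n * a) - t * (k - n * v))) :
    limLogMGF S μ t ≤ t * v - a := by
  have hctop : c ≠ ⊤ := (hc1.trans_lt ENNReal.one_lt_top).ne
  have hc' : 0 < c.toReal := ENNReal.toReal_pos hc hctop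
  set C : ℝ := c.toReal⁻¹ * Real.exp (t * K) with hC
  have hCpos : 0 < C := mul_pos (inv_pos.2 hc') (Real.exp_pos _)
  have htail : ∀ n : ℕ, 1 ≤ n → ∀ k : ℕ,
      Real.exp (t * k) * (walkLaw μ n).toMeasure.real {x | k ≤ wordLength S x}
        ≤ C * Real.exp (n * (t * v - a)) := by
    intro n hn k
    have h1 := h n hn (k - K)
    have e : {x : Γ | (((k : ℤ) - (K : ℤ) : ℤ) : ℝ) + (K : ℝ) ≤ wordLength S x}
        = {x | k ≤ wordLength S x} := by
      ext x
      simp only [Set.mem_ofPred_eq]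
      push_cast
      rw [sub_add_cancel, Nat.cast_le]
    rw [scaledTail, e, ENNReal.toReal_mul] at h1
    have h2 : (walkLaw μ n).toMeasure.real {x | k ≤ wordLength S x}
        ≤ c.toReal⁻¹ * Real.exp (-(n * a) - t * ((((k : ℤ) - (K : ℤ) : ℤ) : ℝ) - n * v)) := by
      rw [← div_eq_inv_mul, le_div_iff₀ hc', mul_comm]
      exact h1
    refine (mul_le_mul_of_nonneg_left h2 (Real.exp_pos _).le).trans (le_of_eq ?_)
    rw [hC, mul_left_comm, mul_assoc, ← Real.exp_add, ← Real.exp_add]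
    congr 2
    push_cast
    ring
  have hmgf : ∀ n : ℕ, 1 ≤ n →
      lengthMGF S μ n t ≤ (M * n + 1) * (C * Real.exp (n * (t * v - a))) := by
    intro n hn
    have h1 : lengthMGF S μ n t ≤ ∫ x, ∑ k ∈ Finset.range (M * n + 1),
        ({x | k ≤ wordLength S x} : Set Γ).indicator (fun _ => Real.exp (t * k)) x
          ∂(walkLaw μ n).toMeasure := by
      refine integral_mono_ae (integrable_wordLength hS hM n (fun k => Real.exp (t * k)))
        (integrable_finsetSum _ fun k _ =>
          (integrable_const _).indicator MeasurableSet.of_discrete) ?_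
      filter_upwards [ae_wordLength_le hS hM n] with x hx
      refine le_trans (le_of_eq ?_) (Finset.single_le_sum (f := fun k =>
        ({x | k ≤ wordLength S x} : Set Γ).indicator (fun _ => Real.exp (t * k)) x)
        (fun k _ => Set.indicator_nonneg (fun _ _ => (Real.exp_pos _).le) _)
        (Finset.mem_range.2 (Nat.lt_succ_of_le hx)))
      simp
    refine h1.trans ?_
    rw [integral_finsetSum _ fun k _ =>
      (integrable_const _).indicator MeasurableSet.of_discrete]
    refine (Finset.sum_le_card_nsmul _ _ (C * Real.exp (n * (t * v - a))) fun k _ => ?_).trans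
      (le_of_eq ?_)
    · rw [integral_indicator_const _ MeasurableSet.of_discrete, smul_eq_mul, mul_comm]
      exact htail n hn k
    · rw [Finset.card_range, nsmul_eq_mul]
      push_cast
      ring
  have hlim : Tendsto (fun n : ℕ => (Real.log ((M + 1) * C)) / n + Real.log n / n + (t * v - a))
      atTop (𝓝 (0 + 0 + (t * v - a))) := by
    refine Tendsto.add_const _ (Tendsto.add (tendsto_const_div_atTop_nhds_zero_nat _) ?_)
    exact (Real.isLittleO_log_id_atTop.tendsto_div_nhds_zero).comp tendsto_natCast_atTop_atTop
  rw [zero_add, zero_add] at hlim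
  refine le_of_tendsto_of_tendsto (tendsto_logMGF hS hM t) hlim ?_
  filter_upwards [eventually_ge_atTop 1] with n hn
  have hn' : (1 : ℝ) ≤ n := by exact_mod_cast hn
  have hn0 : (0 : ℝ) < n := by linarith
  have h1 : lengthMGF S μ n t ≤ ((M + 1) * C) * n * Real.exp (n * (t * v - a)) := by
    refine (hmgf n hn).trans ?_
    have : (M * n + 1 : ℝ) ≤ (M + 1) * n := by nlinarith
    calc _ ≤ ((M + 1) * n : ℝ) * (C * Real.exp (n * (t * v - a))) := by gcongr
      _ = _ := by ring
  have hMC : (0 : ℝ) < (M + 1) * C := by positivity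
  have h2 := Real.log_le_log (lengthMGF_pos hS hM n t) h1
  rw [Real.log_mul (by positivity) (Real.exp_pos _).ne', Real.log_mul hMC.ne' hn0.ne',
    Real.log_exp] at h2
  rw [logMGF_eq, div_le_iff₀ hn0]
  have e : (Real.log ((M + 1) * C) / n + Real.log n / n + (t * v - a)) * n
      = Real.log ((M + 1) * C) + Real.log n + n * (t * v - a) := by
    field_simp
  rw [e]
  exact h2

/-- The lower bound of the large deviation principle: if the rate function is less than `a`
somewhere beyond the rational point `z / w`, then some tail probability at this slope decays more
slowly than `exp (-n a)`. -/
lemma exists_lt_scaledTail (hS : Subgroup.closure S = ⊤)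
    (hM : ∀ g, μ g ≠ 0 → wordLength S g ≤ M) {c : ENNReal} (hc : c ≠ 0) (hc1 : c ≤ 1) {K : ℕ}
    (hA : AlmostAdditive S μ c K) {z : ℤ} {w : ℕ} (hw : 0 < w) {x a b : ℝ} (hx : (z / w : ℝ) < x)
    (hb : ∀ t, x * t - limLogMGF S μ t ≤ b) (hab : b < a) :
    ∃ n : ℕ, 1 ≤ n ∧ Real.exp (-(n * a)) < (scaledTail S μ c K n (n * (z / w))).toReal := by
  by_contra hcon
  push Not at hcon
  have hctop : c ≠ ⊤ := (hc1.trans_lt ENNReal.one_lt_top).ne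
  have htop : ∀ n y, scaledTail S μ c K n y ≠ ⊤ := fun n y =>
    ENNReal.mul_ne_top hctop (measure_ne_top _ _)
  have hone : ∀ n y, (scaledTail S μ c K n y).toReal ≤ 1 := fun n y =>
    ENNReal.toReal_le_of_le_ofReal zero_le_one (by
      rw [ENNReal.ofReal_one]; exact mul_le_one' hc1 prob_le_one)
  have hline := exists_supporting_line (B := fun n y => (scaledTail S μ c K n y).toReal)
    (fun n y => ENNReal.toReal_nonneg)
    (fun n y y' hy => ENNReal.toReal_mono (htop _ _) (by
      refine mul_le_mul_right (measure_mono fun u hu => ?_) c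
      simp only [Set.mem_ofPred_eq] at hu ⊢
      linarith))
    (fun n m y y' => by
      rw [← ENNReal.toReal_mul]
      exact ENNReal.toReal_mono (htop _ _) (hA.mul_le n m y y')) hw hcon
  rcases hline with ⟨t, ht, h⟩ | h
  · have h1 := limLogMGF_le_of_tail hS hM hc hc1 h
    nlinarith [hb t]
  · -- The walk never moves faster than `z / w`, so the rate function is infinite at `x`.
    have h1 : ∀ t, 0 ≤ t → limLogMGF S μ t ≤ t * (z / w) - 0 := fun t ht => by
      refine limLogMGF_le_of_tail hS hM hc hc1 (K := K) fun n hn k => ?_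
      rcases lt_or_ge ((n : ℝ) * (z / w)) k with hk | hk
      · rw [h n hn k hk]; exact (Real.exp_pos _).le
      · refine (hone _ _).trans (Real.one_le_exp ?_)
        nlinarith
    have h3 : 0 < x - z / w := sub_pos.2 hx
    have hpos : 0 ≤ (|b| + 1) / (x - z / w) := by positivity
    have h4 := hb ((|b| + 1) / (x - z / w))
    have h5 := h1 _ hpos
    have h6 : (x - z / w) * ((|b| + 1) / (x - z / w)) = |b| + 1 := mul_div_cancel₀ _ h3.ne'
    have := le_abs_self b
    nlinarith

end LowerBound

/-! ### Independent fields indexed by the Ulam–Harris tree -/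

/-- A label is either the root, or lies in the subtree of one of the children of the root; as labels
list the youngest generation first, the label `v` inside the subtree of the child `i` is `v ++ [i]`
in the whole tree. -/
def labelEquiv : Option (ℕ × List ℕ) ≃ List ℕ where
  toFun o := o.elim [] fun p => p.2 ++ [p.1]
  invFun v := if h : v = [] then none else some (v.getLast h, v.dropLast)
  left_inv o := by cases o <;> simp
  right_inv v := by
    by_cases h : v = []
    · simp [h]
    · simp [h, List.dropLast_append_getLast]

section Graft

variable {A : Type*}

/-- The field on the subtree of the child `i` of the root. -/
def subtree (i : ℕ) (ξ : List ℕ → A) : List ℕ → A := fun v => ξ (v ++ [i])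

/-- The field with value `p.1` at the root and with field `p.2 i` on the subtree of the child `i`. -/
def graft (p : A × (ℕ → List ℕ → A)) : List ℕ → A :=
  fun v => (labelEquiv.symm v).elim p.1 fun q => p.2 q.1 q.2

lemma graft_nil (p : A × (ℕ → List ℕ → A)) : graft p [] = p.1 := by
  simp [graft, labelEquiv]

lemma subtree_graft (p : A × (ℕ → List ℕ → A)) (i : ℕ) : subtree i (graft p) = p.2 i := by
  funext v
  simp [subtree, graft, labelEquiv]

end Graft

section Field

variable {A : Type*} [MeasurableSpace A]

/-- An independent coordinate can be split off a product measure. -/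
lemma map_prod_infinitePi_option {J : Type*} (κ : Measure A) [IsProbabilityMeasure κ] :
    (κ.prod (Measure.infinitePi fun _ : J => κ)).map
        (fun p (o : Option J) => o.elim p.1 p.2)
      = Measure.infinitePi fun _ : Option J => κ := by
  classical
  have hmeas : Measurable fun (p : A × (J → A)) (o : Option J) => o.elim p.1 p.2 := by
    refine measurable_pi_lambda _ fun o => ?_
    cases o with
    | none => exact measurable_fst
    | some j => exact (measurable_pi_apply j).comp measurable_snd
  refine Measure.eq_infinitePi _ fun s t ht => ?_
  rw [Measure.map_apply hmeas (.pi s.countable_toSet fun i _ => ht i)]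
  have e : (fun (p : A × (J → A)) (o : Option J) => o.elim p.1 p.2) ⁻¹' (Set.pi s t)
      = (if none ∈ s then t none else Set.univ) ×ˢ
        (Set.pi (Finset.eraseNone s) fun j => t (some j)) := by
    ext ⟨a, f⟩
    simp only [Set.mem_preimage, Set.mem_pi, SetLike.mem_coe, Set.mem_prod, Finset.mem_eraseNone]
    constructor
    · intro h
      refine ⟨?_, fun j hj => h (some j) hj⟩
      split_ifs with hn
      · exact h none hn
      · trivial
    · rintro ⟨h1, h2⟩ o ho
      cases o with
      | none => simpa [ho] using h1
      | some j => exact h2 j ho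
  rw [e, Measure.prod_prod, Measure.infinitePi_pi _ fun j _ => ht (some j)]
  by_cases hn : none ∈ s
  · have hs : s = Finset.insertNone (Finset.eraseNone s) := by
      rw [Finset.insertNone_eraseNone, Finset.insert_eq_of_mem hn]
    rw [if_pos hn]
    conv_rhs => rw [hs]
    rw [Finset.prod_insertNone]
  · have hs : s = (Finset.eraseNone s).map Function.Embedding.some := by
      rw [Finset.map_some_eraseNone, Finset.erase_eq_of_notMem hn]
    rw [if_neg hn, measure_univ, one_mul]
    conv_rhs => rw [hs]
    rw [Finset.prod_map]
    rfl

lemma measurable_subtree (i : ℕ) : Measurable (subtree (A := A) i) :=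
  measurable_pi_lambda _ fun _ => measurable_pi_apply _

/-- The branching property: in an independent field, the value at the root and the fields on the
subtrees of its children are independent, and the latter have the law of the whole field. -/
lemma measurePreserving_graft (κ : Measure A) [IsProbabilityMeasure κ] :
    MeasurePreserving (graft (A := A))
      (κ.prod (Measure.infinitePi fun _ : ℕ => Measure.infinitePi fun _ : List ℕ => κ))
      (Measure.infinitePi fun _ : List ℕ => κ) := by
  have h1 : MeasurePreserving
      (Prod.map id (MeasurableEquiv.curry ℕ (List ℕ) A).symm)
      (κ.prod (Measure.infinitePi fun _ : ℕ => Measure.infinitePi fun _ : List ℕ => κ))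
      (κ.prod (Measure.infinitePi fun _ : ℕ × List ℕ => κ)) :=
    (MeasurePreserving.id κ).prod ⟨(MeasurableEquiv.curry ℕ (List ℕ) A).symm.measurable,
      Measure.infinitePi_map_curry_symm fun _ _ => κ⟩
  have h2 : MeasurePreserving
      (fun (p : A × (ℕ × List ℕ → A)) (o : Option (ℕ × List ℕ)) => o.elim p.1 p.2)
      (κ.prod (Measure.infinitePi fun _ : ℕ × List ℕ => κ))
      (Measure.infinitePi fun _ : Option (ℕ × List ℕ) => κ) := by
    refine ⟨measurable_pi_lambda _ fun o => ?_, map_prod_infinitePi_option κ⟩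
    cases o with
    | none => exact measurable_fst
    | some j => exact (measurable_pi_apply j).comp measurable_snd
  have h3 : MeasurePreserving (MeasurableEquiv.piCongrLeft (fun _ => A) labelEquiv)
      (Measure.infinitePi fun _ : Option (ℕ × List ℕ) => κ)
      (Measure.infinitePi fun _ : List ℕ => κ) :=
    ⟨(MeasurableEquiv.piCongrLeft (fun _ => A) labelEquiv).measurable,
      Measure.infinitePi_map_piCongrLeft (fun _ => κ) labelEquiv⟩
  have h := h3.comp (h2.comp h1)
  have e : ⇑(MeasurableEquiv.piCongrLeft (fun _ : List ℕ => A) labelEquiv) ∘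
      (fun (p : A × (ℕ × List ℕ → A)) (o : Option (ℕ × List ℕ)) => o.elim p.1 p.2) ∘
        Prod.map id (MeasurableEquiv.curry ℕ (List ℕ) A).symm = graft := by
    funext p v
    obtain ⟨o, rfl⟩ := labelEquiv.surjective v
    simp only [Function.comp_apply, graft, Equiv.symm_apply_apply]
    rw [MeasurableEquiv.coe_piCongrLeft, Equiv.piCongrLeft_apply_apply]
    cases o <;> rfl
  rwa [e] at h

/-- Pairing two independent product fields gives the product field of the product laws. -/
lemma map_zip_infinitePi {ι A' : Type*} [MeasurableSpace A'] (κ : Measure A) (κ' : Measure A')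
    [IsProbabilityMeasure κ] [IsProbabilityMeasure κ'] :
    ((Measure.infinitePi fun _ : ι => κ).prod (Measure.infinitePi fun _ : ι => κ')).map
        (fun p i => (p.1 i, p.2 i))
      = Measure.infinitePi fun _ : ι => κ.prod κ' := by
  refine ((Measure.isProjectiveLimit_infinitePi fun _ : ι => κ.prod κ').unique fun I => ?_).symm
  have hzip : Measurable fun (p : (ι → A) × (ι → A')) i => (p.1 i, p.2 i) := by fun_prop
  rw [Measure.map_map (Finset.measurable_restrict I) hzip]
  have e : I.restrict ∘ (fun (p : (ι → A) × (ι → A')) i => (p.1 i, p.2 i))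
      = (MeasurableEquiv.arrowProdEquivProdArrow A A' I).symm ∘
          Prod.map I.restrict I.restrict := by
    funext p
    rfl
  have h1 : MeasurePreserving (Prod.map I.restrict I.restrict)
      ((Measure.infinitePi fun _ : ι => κ).prod (Measure.infinitePi fun _ : ι => κ'))
      ((Measure.pi fun _ : I => κ).prod (Measure.pi fun _ : I => κ')) :=
    MeasurePreserving.prod
      ⟨Finset.measurable_restrict I, Measure.infinitePi_map_restrict _⟩
      ⟨Finset.measurable_restrict I, Measure.infinitePi_map_restrict _⟩
  rw [e]
  exact ((measurePreserving_arrowProdEquivProdArrow A A' I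
    (fun _ => κ) (fun _ => κ')).symm.comp h1).map_eq

end Field

/-! ### Offspring distributions of mean larger than one -/

section Offspring

open scoped ENNReal

lemma one_sub_pow_le {y : ℝ} (hy0 : 0 ≤ y) (hy1 : y ≤ 1) (k : ℕ) :
    (1 - y) ^ k ≤ 1 - k * y + (k * y) ^ 2 := by
  have h1 : 1 + (k : ℝ) * y ≤ (1 + y) ^ k := one_add_mul_le_pow (by linarith) k
  have h2 : (1 - y) ^ k * (1 + y) ^ k ≤ 1 := by
    rw [← mul_pow]
    exact pow_le_one₀ (by nlinarith) (by nlinarith)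
  have h3 : 0 ≤ (1 - y) ^ k := pow_nonneg (by linarith) k
  have h4 : 0 ≤ (k : ℝ) * y := by positivity
  have h5 : (1 - y) ^ k * (1 + k * y) ≤ 1 := (mul_le_mul_of_nonneg_left h1 h3).trans h2
  by_contra hcon
  push Not at hcon
  have h6 := mul_lt_mul_of_pos_right hcon (by linarith : 0 < 1 + (k : ℝ) * y)
  nlinarith [pow_nonneg h4 3]

/-- If `l` is less than the mean and every child independently has a property with probability
`q ≥ f`, where `f ≤ δ`, then some child has the property with probability at least `l f`. -/
lemma exists_offspring_bound (π : PMF ℕ) {ρ : ℝ}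
    (hρ : HasSum (fun k : ℕ => (k : ℝ) * (π k).toReal) ρ) {l : ℝ} (hl0 : 0 ≤ l) (hl : l < ρ) :
    ∃ δ : ℝ≥0∞, δ ≠ 0 ∧ ∀ q f : ℝ≥0∞, f ≤ δ → f ≤ q → q ≤ 1 →
      ENNReal.ofReal l * f ≤ ∫⁻ k, (1 - (1 - q) ^ k) ∂π.toMeasure := by
  obtain ⟨K, hK⟩ := ((tendsto_order.1 hρ.tendsto_sum_nat).1 l hl).exists
  set s := ∑ k ∈ Finset.range K, (k : ℝ) * (π k).toReal with hs
  have hs0 : 0 < s := hl0.trans_lt hK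
  set d : ℝ := min 1 ((s - l) / (K * s + 1)) with hd
  have hKs : 0 < K * s + 1 := by positivity
  have hd0 : 0 < d := lt_min one_pos (div_pos (by linarith) hKs)
  have hd1 : d ≤ 1 := min_le_left _ _
  have hdK : d * (K * s) ≤ s - l := by
    have h1 : d * (K * s + 1) ≤ s - l := by
      rw [← le_div_iff₀ hKs]; exact min_le_right _ _
    nlinarith
  refine ⟨ENNReal.ofReal d, (ENNReal.ofReal_pos.2 hd0).ne',
    fun q f hfd hfq hq => ?_⟩
  have hftop : f ≠ ⊤ := (hfd.trans_lt ENNReal.ofReal_lt_top).ne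
  obtain ⟨y, hy0, rfl⟩ : ∃ y, 0 ≤ y ∧ f = ENNReal.ofReal y :=
    ⟨f.toReal, ENNReal.toReal_nonneg, (ENNReal.ofReal_toReal hftop).symm⟩
  have hyd : y ≤ d := (ENNReal.ofReal_le_ofReal_iff hd0.le).1 hfd
  have hy1 : y ≤ 1 := hyd.trans hd1
  rw [lintegral_toMeasure]
  calc ENNReal.ofReal l * ENNReal.ofReal y
      ≤ ENNReal.ofReal (∑ k ∈ Finset.range K, (π k).toReal * (1 - (1 - y) ^ k)) := by
        rw [← ENNReal.ofReal_mul hl0]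
        refine ENNReal.ofReal_le_ofReal ?_
        have h1 : ∀ k ∈ Finset.range K, (k : ℝ) * (π k).toReal * (y * (1 - K * d))
            ≤ (π k).toReal * (1 - (1 - y) ^ k) := by
          intro k hk
          have hkK : (k : ℝ) ≤ K := by exact_mod_cast (Finset.mem_range.1 hk).le
          have h2 := one_sub_pow_le hy0 hy1 k
          have h3 : (k : ℝ) * y ≤ K * d := by gcongr
          have h4 : (k : ℝ) * y * (1 - K * d) ≤ 1 - (1 - y) ^ k := by
            have : 0 ≤ (k : ℝ) * y := by positivity
            nlinarith
          have h5 := mul_le_mul_of_nonneg_left h4 (ENNReal.toReal_nonneg (a := π k))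
          linarith
        refine le_trans ?_ (Finset.sum_le_sum h1)
        rw [← Finset.sum_mul, ← hs]
        nlinarith
    _ = ∑ k ∈ Finset.range K, π k * (1 - (1 - ENNReal.ofReal y) ^ k) := by
        have hp : ∀ k : ℕ, (1 - y) ^ k ≤ 1 := fun k => pow_le_one₀ (by linarith) (by linarith)
        rw [ENNReal.ofReal_sum_of_nonneg fun k _ =>
          mul_nonneg ENNReal.toReal_nonneg (by linarith [hp k])]
        refine Finset.sum_congr rfl fun k _ => ?_
        rw [ENNReal.ofReal_mul ENNReal.toReal_nonneg, ENNReal.ofReal_toReal (π.apply_ne_top k),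
          ENNReal.ofReal_sub _ (pow_nonneg (by linarith) k), ENNReal.ofReal_one,
          ENNReal.ofReal_pow (by linarith), ENNReal.ofReal_sub _ hy0, ENNReal.ofReal_one]
    _ ≤ ∑ k ∈ Finset.range K, π k * (1 - (1 - q) ^ k) := by
        gcongr
    _ ≤ ∑' k, π k * (1 - (1 - q) ^ k) := ENNReal.sum_le_tsum _

lemma exists_two_le_of_one_lt_mean (π : PMF ℕ) {ρ : ℝ}
    (hρ : HasSum (fun k : ℕ => (k : ℝ) * (π k).toReal) ρ) (hρ1 : 1 < ρ) :
    ∃ k, 2 ≤ k ∧ π k ≠ 0 := by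
  by_contra hcon
  push Not at hcon
  have h1 : HasSum (fun k : ℕ => (k : ℝ) * (π k).toReal) ((1 : ℕ) * (π 1).toReal) := by
    refine hasSum_single 1 fun k hk => ?_
    rcases Nat.eq_zero_or_pos k with rfl | hk0
    · simp
    · rw [hcon k (by omega)]; simp
  have h2 := hρ.unique h1
  have h3 : (π 1).toReal ≤ 1 := ENNReal.toReal_le_of_le_ofReal zero_le_one (by
    rw [ENNReal.ofReal_one]; exact π.coe_le_one 1)
  rw [Nat.cast_one, one_mul] at h2
  linarith

/-- The only solution in `[0, 1)` of `s ≤ ∑ π(k) sᵏ` is zero, when every particle has a child and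
some have two. -/
lemma eq_zero_of_le_generating (π : PMF ℕ) (h0 : π 0 = 0) {k : ℕ} (hk : 2 ≤ k) (hπk : π k ≠ 0)
    {s : ℝ≥0∞} (hs1 : s < 1) (hs : s ≤ ∫⁻ k, s ^ k ∂π.toMeasure) : s = 0 := by
  by_contra hs0
  have hs_ne_top : s ≠ ⊤ := (hs1.trans ENNReal.one_lt_top).ne
  rw [lintegral_toMeasure] at hs
  have hsum : ∑' k, π k * s = s := by rw [ENNReal.tsum_mul_right, π.tsum_coe, one_mul]
  refine hs.not_gt ?_
  have hle : ∀ j, π j * s ^ j ≤ π j * s := by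
    intro j
    rcases Nat.eq_zero_or_pos j with rfl | hj
    · simp [h0]
    · gcongr
      calc s ^ j ≤ s ^ 1 := pow_le_pow_right_of_le_one' hs1.le hj
        _ = s := pow_one s
  have hlt : π k * s ^ k < π k * s := by
    refine ENNReal.mul_lt_mul_right hπk (π.apply_ne_top k) ?_
    calc s ^ k ≤ s ^ 2 := pow_le_pow_right_of_le_one' hs1.le hk
      _ = s * s := pow_two s
      _ < s * 1 := ENNReal.mul_lt_mul_right hs0 hs_ne_top hs1
      _ = s := mul_one s
  calc ∑' j, π j * s ^ j < ∑' j, π j * s :=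
        ENNReal.tsum_lt_tsum ((ENNReal.tsum_le_tsum hle).trans_lt (by
          rw [hsum]; exact hs_ne_top.lt_top)).ne hle hlt
    _ = s := hsum

end Offspring

/-! ### The branching property -/

section Branching

variable {Γ : Type*} [Countable Γ] [MeasurableSpace Γ] [DiscreteMeasurableSpace Γ] [Group Γ]

open scoped ENNReal

/-- The law of the field of pairs (number of children, step), independent over all labels. -/
noncomputable def fieldLaw (π : PMF ℕ) (μ : PMF Γ) : Measure (List ℕ → ℕ × Γ) :=
  Measure.infinitePi fun _ => π.toMeasure.prod μ.toMeasure

instance (π : PMF ℕ) (μ : PMF Γ) : IsProbabilityMeasure (fieldLaw π μ) := by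
  unfold fieldLaw; infer_instance

/-- Some child of a root particle, born at position `g` and making its step from there, has a
subtree in the event `K`, where `K` depends on the birth place of the particle. -/
def childEvent (K : Γ → Set (List ℕ → ℕ × Γ)) (g : Γ) : Set (List ℕ → ℕ × Γ) :=
  {ξ | ∃ c < (ξ []).1, subtree c ξ ∈ K (g * (ξ []).2)}

lemma measurableSet_childEvent {K : Γ → Set (List ℕ → ℕ × Γ)} (hK : ∀ g, MeasurableSet (K g))
    (g : Γ) : MeasurableSet (childEvent K g) := by
  have e : childEvent K g = ⋃ (c : ℕ) (x : Γ), {ξ | c < (ξ []).1} ∩ {ξ | (ξ []).2 = x} ∩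
      subtree c ⁻¹' (K (g * x)) := by
    ext ξ
    simp [childEvent, and_assoc]
  rw [e]
  have h : Measurable fun ξ : List ℕ → ℕ × Γ => ξ [] := measurable_pi_apply _
  refine MeasurableSet.iUnion fun c => MeasurableSet.iUnion fun x => ?_
  refine (MeasurableSet.inter ?_ ?_).inter (measurable_subtree c (hK _))
  · exact (measurable_fst.comp h) (MeasurableSet.of_discrete (s := {n : ℕ | c < n}))
  · exact (measurable_snd.comp h) (measurableSet_singleton x)

omit [Group Γ] in
lemma lintegral_fieldLaw (π : PMF ℕ) (μ : PMF Γ) {f : (List ℕ → ℕ × Γ) → ℝ≥0∞}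
    (hf : Measurable f) :
    ∫⁻ ξ, f ξ ∂fieldLaw π μ = ∫⁻ x, ∫⁻ k, ∫⁻ η, f (graft ((k, x), η))
      ∂(Measure.infinitePi fun _ : ℕ => fieldLaw π μ) ∂π.toMeasure ∂μ.toMeasure := by
  have hg := measurePreserving_graft (π.toMeasure.prod μ.toMeasure)
  unfold fieldLaw
  rw [← hg.lintegral_comp hf,
    lintegral_prod (fun p => f (graft p)) (hf.comp hg.measurable).aemeasurable,
    lintegral_prod_symm _ Measurable.of_discrete.aemeasurable]

omit [Group Γ] in
lemma fieldLaw_apply (π : PMF ℕ) (μ : PMF Γ) {s : Set (List ℕ → ℕ × Γ)} (hs : MeasurableSet s) :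
    fieldLaw π μ s = ∫⁻ x, ∫⁻ k, (Measure.infinitePi fun _ : ℕ => fieldLaw π μ)
      {η | graft ((k, x), η) ∈ s} ∂π.toMeasure ∂μ.toMeasure := by
  rw [← lintegral_indicator_one hs, lintegral_fieldLaw π μ (measurable_one.indicator hs)]
  refine lintegral_congr fun x => lintegral_congr fun k => ?_
  have hm : MeasurableSet {η : ℕ → List ℕ → ℕ × Γ | graft ((k, x), η) ∈ s} :=
    ((measurePreserving_graft (π.toMeasure.prod μ.toMeasure)).measurable.comp
      measurable_prodMk_left) hs
  rw [← lintegral_indicator_one hm]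
  rfl

lemma infinitePi_forall_lt {X : Type*} [MeasurableSpace X] (Q : Measure X) [IsProbabilityMeasure Q]
    {s : Set X} (hs : MeasurableSet s) (k : ℕ) :
    (Measure.infinitePi fun _ : ℕ => Q) {η | ∀ c < k, η c ∈ s} = Q s ^ k := by
  have e : {η : ℕ → X | ∀ c < k, η c ∈ s} = Set.pi (Finset.range k) fun _ => s := by
    ext η; simp [Set.mem_pi]
  rw [e, Measure.infinitePi_pi _ fun _ _ => hs]
  simp

lemma infinitePi_exists_lt {X : Type*} [MeasurableSpace X] (Q : Measure X) [IsProbabilityMeasure Q]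
    {s : Set X} (hs : MeasurableSet s) (k : ℕ) :
    (Measure.infinitePi fun _ : ℕ => Q) {η | ∃ c < k, η c ∈ s} = 1 - (1 - Q s) ^ k := by
  have hm : MeasurableSet {η : ℕ → X | ∀ c < k, η c ∈ sᶜ} := by
    have e : {η : ℕ → X | ∀ c < k, η c ∈ sᶜ} = Set.pi (Finset.range k) fun _ => sᶜ := by
      ext η; simp [Set.mem_pi]
    rw [e]
    exact MeasurableSet.pi (Finset.countable_toSet _) fun _ _ => hs.compl
  have e : {η : ℕ → X | ∃ c < k, η c ∈ s} = {η | ∀ c < k, η c ∈ sᶜ}ᶜ := by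
    ext η; simp
  rw [e, prob_compl_eq_one_sub hm, infinitePi_forall_lt Q hs.compl, prob_compl_eq_one_sub hs]

lemma fieldLaw_childEvent (π : PMF ℕ) (μ : PMF Γ) {K : Γ → Set (List ℕ → ℕ × Γ)}
    (hK : ∀ g, MeasurableSet (K g)) (g : Γ) :
    fieldLaw π μ (childEvent K g)
      = ∫⁻ x, ∫⁻ k, (1 - (1 - fieldLaw π μ (K (g * x))) ^ k) ∂π.toMeasure ∂μ.toMeasure := by
  rw [fieldLaw_apply π μ (measurableSet_childEvent hK g)]
  refine lintegral_congr fun x => lintegral_congr fun k => ?_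
  rw [← infinitePi_exists_lt _ (hK _)]
  congr 1
  ext η
  simp [childEvent, graft_nil, subtree_graft]

omit [Group Γ] in
/-- If every particle has a child and some have several, then an event of probability less than one
which forces itself on the subtrees of all children of the root has probability zero. -/
lemma fieldLaw_eq_zero_of_inherited (π : PMF ℕ) (h0 : π 0 = 0) {ρ : ℝ}
    (hρ : HasSum (fun k : ℕ => (k : ℝ) * (π k).toReal) ρ) (hρ1 : 1 < ρ) (μ : PMF Γ)
    {s : Set (List ℕ → ℕ × Γ)} (hs : MeasurableSet s)
    (hsub : ∀ ξ ∈ s, ∀ c < (ξ []).1, subtree c ξ ∈ s) (hlt : fieldLaw π μ s < 1) :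
    fieldLaw π μ s = 0 := by
  obtain ⟨k, hk, hπk⟩ := exists_two_le_of_one_lt_mean π hρ hρ1
  refine eq_zero_of_le_generating π h0 hk hπk hlt ?_
  calc fieldLaw π μ s = _ := fieldLaw_apply π μ hs
    _ ≤ ∫⁻ _, ∫⁻ k, fieldLaw π μ s ^ k ∂π.toMeasure ∂μ.toMeasure := by
        refine lintegral_mono fun x => lintegral_mono fun k => ?_
        rw [← infinitePi_forall_lt _ hs]
        refine measure_mono fun η hη c hc => ?_
        have := hsub _ hη c (by simpa [graft_nil] using hc)
        rwa [subtree_graft] at this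
    _ = _ := by simp

lemma measurableSet_iterate_childEvent {K : Γ → Set (List ℕ → ℕ × Γ)}
    (hK : ∀ g, MeasurableSet (K g)) (n : ℕ) (g : Γ) : MeasurableSet (childEvent^[n] K g) := by
  induction n generalizing g with
  | zero => exact hK g
  | succ n ih => rw [Function.iterate_succ_apply']; exact measurableSet_childEvent ih g

/-- A first-moment lower bound for the probability that some descendant in generation `n` lies in
`K`, valid as long as this probability is small. -/
lemma le_fieldLaw_iterate_childEvent {π : PMF ℕ} {μ : PMF Γ} {l : ℝ} (hl : 1 ≤ l)
    {δ : ℝ≥0∞} (hδ : ∀ q f : ℝ≥0∞, f ≤ δ → f ≤ q → q ≤ 1 →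
      ENNReal.ofReal l * f ≤ ∫⁻ k, (1 - (1 - q) ^ k) ∂π.toMeasure)
    {m : ℕ} {η : ℝ≥0∞} (hη : ENNReal.ofReal l ^ m * η ≤ δ)
    {K : Γ → Set (List ℕ → ℕ × Γ)} (hK : ∀ g, MeasurableSet (K g)) {f : Γ → ℝ≥0∞}
    (hfK : ∀ g, f g ≤ fieldLaw π μ (K g)) (hfη : ∀ g, f g ≤ η) {n : ℕ} (hn : n ≤ m) (g : Γ) :
    ENNReal.ofReal l ^ n * ∫⁻ y, f (g * y) ∂(walkLaw μ n).toMeasure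
      ≤ fieldLaw π μ (childEvent^[n] K g) := by
  induction n generalizing g with
  | zero =>
    rw [lintegral_walkLaw_zero]
    simpa using hfK g
  | succ n ih =>
    rw [Function.iterate_succ_apply',
      fieldLaw_childEvent π μ (measurableSet_iterate_childEvent hK n), lintegral_walkLaw_succ',
      ← lintegral_const_mul _ Measurable.of_discrete]
    refine lintegral_mono fun x => ?_
    have h1 := ih (by omega) (g * x)
    simp_rw [← mul_assoc]
    rw [pow_succ', mul_assoc]
    refine hδ _ _ ?_ h1 prob_le_one
    refine le_trans ?_ hη
    have hl' : 1 ≤ ENNReal.ofReal l := by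
      rw [← ENNReal.ofReal_one]; exact ENNReal.ofReal_le_ofReal hl
    refine mul_le_mul' (pow_le_pow_right' hl' (by omega)) ?_
    calc ∫⁻ y, f (g * x * y) ∂(walkLaw μ n).toMeasure
        ≤ ∫⁻ _, η ∂(walkLaw μ n).toMeasure := lintegral_mono fun y => hfη _
      _ = η := by simp

end Branching

/-! ### Generations and subtrees -/

section Tree

variable {Γ : Type*} [Group Γ]

/-- The numbers of children in a field of pairs. -/
abbrev offspring (ξ : List ℕ → ℕ × Γ) : List ℕ → ℕ := fun v => (ξ v).1

/-- The steps in a field of pairs. -/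
abbrev steps (ξ : List ℕ → ℕ × Γ) : List ℕ → Γ := fun v => (ξ v).2

lemma mem_generation_succ {N : List ℕ → ℕ} {n : ℕ} {u : List ℕ} :
    u ∈ generation N (n + 1) ↔ ∃ v ∈ generation N n, ∃ k < N v, k :: v = u := by
  simp [generation]

lemma mem_generation_succ_iff_append (N : List ℕ → ℕ) (n : ℕ) (u : List ℕ) :
    u ∈ generation N (n + 1) ↔
      ∃ c < N [], ∃ v ∈ generation (subtree c N) n, u = v ++ [c] := by
  induction n generalizing u with
  | zero =>
    rw [mem_generation_succ]
    simp [generation, eq_comm]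
  | succ n ih =>
    rw [mem_generation_succ]
    constructor
    · rintro ⟨v, hv, k, hk, rfl⟩
      obtain ⟨c, hc, w, hw, rfl⟩ := (ih v).1 hv
      exact ⟨c, hc, k :: w, mem_generation_succ.2 ⟨w, hw, k, hk, rfl⟩, rfl⟩
    · rintro ⟨c, hc, v, hv, rfl⟩
      obtain ⟨w, hw, k, hk, rfl⟩ := mem_generation_succ.1 hv
      exact ⟨w ++ [c], (ih _).2 ⟨c, hc, w, hw, rfl⟩, k, hk, rfl⟩

lemma position_append (ζ : List ℕ → Γ) (v : List ℕ) (c : ℕ) :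
    position ζ (v ++ [c]) = ζ [c] * position (subtree c ζ) v := by
  induction v with
  | nil => simp [position]
  | cons k v ih =>
    rw [List.cons_append, position, ih, position, mul_assoc]
    rfl

/-- The iterated child event looks at the birth places of the particles of generation `n`, when the
root particle is born at `g`. -/
lemma mem_iterate_childEvent (T : Set Γ) (n : ℕ) (g : Γ) (ξ : List ℕ → ℕ × Γ) :
    ξ ∈ childEvent^[n] (fun g' => {_ξ | g' ∈ T}) g ↔
      ∃ v ∈ generation (offspring ξ) n,
        g * (steps ξ [] * position (steps ξ) v * (steps ξ v)⁻¹) ∈ T := by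
  induction n generalizing g ξ with
  | zero => simp [generation, position]
  | succ n ih =>
    rw [Function.iterate_succ_apply']
    have e : ∀ (v : List ℕ) (c : ℕ),
        g * (steps ξ [] * position (steps ξ) (v ++ [c]) * (steps ξ (v ++ [c]))⁻¹)
          = g * (ξ []).2 * (steps (subtree c ξ) [] * position (steps (subtree c ξ)) v *
            (steps (subtree c ξ) v)⁻¹) := by
      intro v c
      rw [position_append]
      simp only [mul_assoc]
      rfl
    constructor
    · rintro ⟨c, hc, h⟩
      obtain ⟨v, hv, hT⟩ := (ih _ _).1 h
      refine ⟨v ++ [c], (mem_generation_succ_iff_append _ _ _).2 ⟨c, hc, v, hv, rfl⟩, ?_⟩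
      rwa [e]
    · rintro ⟨u, hu, hT⟩
      obtain ⟨c, hc, v, hv, rfl⟩ := (mem_generation_succ_iff_append _ _ _).1 hu
      refine ⟨c, hc, (ih _ _).2 ⟨v, hv, ?_⟩⟩
      rwa [e] at hT

lemma childEvent_mono {K K' : Γ → Set (List ℕ → ℕ × Γ)} (h : ∀ g, K g ⊆ K' g) (g : Γ) :
    childEvent K g ⊆ childEvent K' g :=
  fun _ ⟨c, hc, hK⟩ => ⟨c, hc, h _ hK⟩

lemma iterate_childEvent_mono {K K' : Γ → Set (List ℕ → ℕ × Γ)} (h : ∀ g, K g ⊆ K' g) (n : ℕ)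
    (g : Γ) : childEvent^[n] K g ⊆ childEvent^[n] K' g := by
  induction n generalizing g with
  | zero => exact h g
  | succ n ih =>
    rw [Function.iterate_succ_apply', Function.iterate_succ_apply']
    exact childEvent_mono ih g

/-- There is a line of descent of `j` blocks of `m` generations each, along which every block
increases the word length of the birth place by at least `s`. -/
def chainEvent (S : Set Γ) (m : ℕ) (s : ℝ) : ℕ → Γ → Set (List ℕ → ℕ × Γ)
  | 0, _ => Set.univ
  | j + 1, g => childEvent^[m] (fun g' => {ξ | (wordLength S g : ℝ) + s ≤ wordLength S g' ∧
      ξ ∈ chainEvent S m s j g'}) g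

lemma chainEvent_subset (S : Set Γ) (m : ℕ) (s : ℝ) {i j : ℕ} (hij : i ≤ j) (g : Γ) :
    chainEvent S m s j g ⊆ childEvent^[i * m]
      (fun g' => {_ξ | g' ∈ {g' | (wordLength S g : ℝ) + i * s ≤ wordLength S g'}}) g := by
  induction i generalizing j g with
  | zero =>
    intro ξ _
    simp
  | succ i ih =>
    obtain ⟨j, rfl⟩ : ∃ j', j = j' + 1 := ⟨j - 1, by omega⟩
    rw [show (i + 1) * m = m + i * m by ring, Function.iterate_add_apply]
    refine iterate_childEvent_mono (fun g' => ?_) m g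
    rintro ξ ⟨hg', hξ⟩
    refine iterate_childEvent_mono (fun g'' => ?_) _ _ (ih (by omega) g' hξ)
    intro ξ' hξ'
    simp only [Set.mem_ofPred_eq] at hξ' ⊢
    push_cast
    linarith

end Tree

/-! ### Survival of fast lines of descent -/

section Survival

open scoped ENNReal

variable {Γ : Type*} [Countable Γ] [MeasurableSpace Γ] [DiscreteMeasurableSpace Γ] [Group Γ]
  {S : Set Γ} {μ : PMF Γ} {M : ℕ} {π : PMF ℕ}

lemma measurableSet_chainEvent (m : ℕ) (s : ℝ) (j : ℕ) (g : Γ) :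
    MeasurableSet (chainEvent S m s j g) := by
  induction j generalizing g with
  | zero => exact MeasurableSet.univ
  | succ j ih =>
    exact measurableSet_iterate_childEvent (fun g' => (MeasurableSet.const _).inter (ih g')) m g

lemma le_fieldLaw_chainEvent {l : ℝ} (hl : 1 ≤ l)
    {δ : ℝ≥0∞} (hδ : ∀ q f : ℝ≥0∞, f ≤ δ → f ≤ q → q ≤ 1 →
      ENNReal.ofReal l * f ≤ ∫⁻ k, (1 - (1 - q) ^ k) ∂π.toMeasure)
    {m : ℕ} {η : ℝ≥0∞} (hη : ENNReal.ofReal l ^ m * η ≤ δ) (hη1 : η ≤ 1) {s : ℝ}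
    (hs : ∀ g, 1 ≤ ENNReal.ofReal l ^ m *
      (walkLaw μ m).toMeasure {x | (wordLength S g : ℝ) + s ≤ wordLength S (g * x)})
    (j : ℕ) (g : Γ) : η ≤ fieldLaw π μ (chainEvent S m s j g) := by
  induction j generalizing g with
  | zero => simpa [chainEvent] using hη1
  | succ j ih =>
    set good : Set Γ := {g' | (wordLength S g : ℝ) + s ≤ wordLength S g'} with hgood
    have h := le_fieldLaw_iterate_childEvent (μ := μ) hl hδ hη
      (K := fun g' => {ξ | (wordLength S g : ℝ) + s ≤ wordLength S g' ∧
        ξ ∈ chainEvent S m s j g'})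
      (fun g' => (MeasurableSet.const _).inter (measurableSet_chainEvent m s j g'))
      (f := good.indicator fun _ => η) (fun g' => ?_)
      (fun g' => Set.indicator_le_self' (fun _ _ => zero_le) _) le_rfl g
    · refine le_trans ?_ h
      have e : ∫⁻ y, good.indicator (fun _ => η) (g * y) ∂(walkLaw μ m).toMeasure
          = η * (walkLaw μ m).toMeasure
              {x | (wordLength S g : ℝ) + s ≤ wordLength S (g * x)} := by
        rw [← lintegral_indicator_const MeasurableSet.of_discrete]
        rfl
      rw [e, mul_left_comm]
      exact le_mul_of_one_le_right' (hs g)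
    · by_cases hg' : g' ∈ good
      · rw [Set.indicator_of_mem hg']
        refine (ih g').trans (measure_mono fun ξ hξ => ⟨hg', hξ⟩)
      · rw [Set.indicator_of_notMem hg']
        exact zero_le

lemma measurable_position (v : List ℕ) :
    Measurable fun ξ : List ℕ → ℕ × Γ => position (steps ξ) v := by
  induction v with
  | nil => exact measurable_const
  | cons k v ih =>
    have h : Measurable fun ξ : List ℕ → ℕ × Γ => steps ξ (k :: v) :=
      measurable_snd.comp (measurable_pi_apply _)
    exact (Measurable.of_discrete (f := fun p : Γ × Γ => p.1 * p.2)).comp (ih.prodMk h)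

omit [Countable Γ] [DiscreteMeasurableSpace Γ] [Group Γ] in
lemma measurableSet_mem_generation (n : ℕ) (u : List ℕ) :
    MeasurableSet {ξ : List ℕ → ℕ × Γ | u ∈ generation (offspring ξ) n} := by
  induction n generalizing u with
  | zero => exact MeasurableSet.const _
  | succ n ih =>
    simp_rw [mem_generation_succ]
    have e : {ξ : List ℕ → ℕ × Γ | ∃ v ∈ generation (offspring ξ) n, ∃ k < offspring ξ v,
        k :: v = u} = ⋃ (v : List ℕ) (k : ℕ), {ξ | v ∈ generation (offspring ξ) n} ∩
          ({ξ | k < (ξ v).1} ∩ {_ξ | k :: v = u}) := by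
      ext ξ
      simp
    rw [e]
    refine MeasurableSet.iUnion fun v => MeasurableSet.iUnion fun k => (ih v).inter
      (MeasurableSet.inter ?_ (MeasurableSet.const _))
    exact (measurable_fst.comp (measurable_pi_apply v))
      (MeasurableSet.of_discrete (s := {n : ℕ | k < n}))

lemma measurableSet_exists_generation (n : ℕ) (T : Set Γ) :
    MeasurableSet {ξ : List ℕ → ℕ × Γ |
      ∃ u ∈ generation (offspring ξ) n, position (steps ξ) u ∈ T} := by
  have e : {ξ : List ℕ → ℕ × Γ | ∃ u ∈ generation (offspring ξ) n, position (steps ξ) u ∈ T}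
      = ⋃ u : List ℕ, {ξ | u ∈ generation (offspring ξ) n} ∩
          {ξ | position (steps ξ) u ∈ T} := by
    ext ξ
    simp
  rw [e]
  exact MeasurableSet.iUnion fun u => (measurableSet_mem_generation n u).inter
    (measurable_position u (MeasurableSet.of_discrete (s := T)))

/-- The maximal displacement is at least `v n`, up to a constant. -/
def fastEvent (S : Set Γ) (v : ℝ) : Set (List ℕ → ℕ × Γ) :=
  {ξ | ∃ C : ℕ, ∀ n : ℕ, ∃ u ∈ generation (offspring ξ) n,
    v * n ≤ wordLength S (position (steps ξ) u) + C}

lemma measurableSet_fastEvent (v : ℝ) : MeasurableSet (fastEvent S v) := by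
  have e : fastEvent S v = ⋃ C : ℕ, ⋂ n : ℕ, {ξ : List ℕ → ℕ × Γ |
      ∃ u ∈ generation (offspring ξ) n,
        position (steps ξ) u ∈ {x : Γ | v * n ≤ wordLength S x + C}} := by
    ext ξ
    simp [fastEvent]
  rw [e]
  exact MeasurableSet.iUnion fun C => MeasurableSet.iInter fun n =>
    measurableSet_exists_generation n _

omit [Countable Γ] [MeasurableSpace Γ] [DiscreteMeasurableSpace Γ] in
lemma mem_fastEvent_of_subtree (hS : Subgroup.closure S = ⊤) {v : ℝ} {ξ : List ℕ → ℕ × Γ} {c : ℕ}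
    (hc : c < (ξ []).1) (h : subtree c ξ ∈ fastEvent S v) : ξ ∈ fastEvent S v := by
  obtain ⟨C, hC⟩ := h
  refine ⟨C + wordLength S (ξ [c]).2 + ⌈|v|⌉₊, fun n => ?_⟩
  have hceil : |v| ≤ (⌈|v|⌉₊ : ℝ) := Nat.le_ceil _
  have hv := le_abs_self v
  rcases n with _ | n
  · refine ⟨[], by simp [generation], ?_⟩
    simp only [Nat.cast_zero, mul_zero]
    positivity
  · obtain ⟨u, hu, h⟩ := hC n
    refine ⟨u ++ [c], (mem_generation_succ_iff_append _ _ _).2 ⟨c, hc, u, hu, rfl⟩, ?_⟩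
    rw [position_append]
    have h1 := wordLength_le_mul_left hS (ξ [c]).2 (position (steps (subtree c ξ)) u)
    have h2 : (wordLength S (position (steps (subtree c ξ)) u) : ℝ) ≤ wordLength S (ξ [c]).2 +
        wordLength S ((ξ [c]).2 * position (steps (subtree c ξ)) u) := by exact_mod_cast h1
    change v * ((n + 1 : ℕ) : ℝ)
      ≤ wordLength S ((ξ [c]).2 * position (steps (subtree c ξ)) u) + _
    push_cast
    linarith

lemma ae_fieldLaw_step_le (hM : ∀ g, μ g ≠ 0 → wordLength S g ≤ M) :
    ∀ᵐ ξ ∂fieldLaw π μ, ∀ v, wordLength S (ξ v).2 ≤ M := by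
  rw [ae_all_iff]
  intro v
  have h1 : MeasurePreserving (fun ξ : List ℕ → ℕ × Γ => (ξ v).2) (fieldLaw π μ) μ.toMeasure :=
    measurePreserving_snd.comp (measurePreserving_eval_infinitePi _ v)
  exact h1.quasiMeasurePreserving.ae ((ae_toMeasure_iff μ fun g => wordLength S g ≤ M).2 hM)

omit [DiscreteMeasurableSpace Γ] [Group Γ] in
lemma ae_fieldLaw_offspring_pos (h0 : π 0 = 0) :
    ∀ᵐ ξ ∂fieldLaw π μ, ∀ v, 0 < (ξ v).1 := by
  rw [ae_all_iff]
  intro v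
  have h1 : MeasurePreserving (fun ξ : List ℕ → ℕ × Γ => (ξ v).1) (fieldLaw π μ) π.toMeasure :=
    measurePreserving_fst.comp (measurePreserving_eval_infinitePi _ v)
  refine h1.quasiMeasurePreserving.ae ((ae_toMeasure_iff π fun n => 0 < n).2 fun n hn => ?_)
  rcases Nat.eq_zero_or_pos n with rfl | h
  · exact absurd h0 hn
  · exact h

omit [Countable Γ] [MeasurableSpace Γ] [DiscreteMeasurableSpace Γ] in
/-- It suffices to control the maximal displacement along multiples of `m`, since a particle always
has a child and steps are bounded. -/
lemma mem_fastEvent_of_multiples (hS : Subgroup.closure S = ⊤) {v : ℝ} {m : ℕ}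
    (hm : 0 < m) {C : ℕ} {ξ : List ℕ → ℕ × Γ} (hpos : ∀ v, 0 < (ξ v).1)
    (hM : ∀ v, wordLength S (ξ v).2 ≤ M)
    (h : ∀ i : ℕ, ∃ u ∈ generation (offspring ξ) (i * m),
      v * ((i * m : ℕ) : ℝ) ≤ wordLength S (position (steps ξ) u) + C) : ξ ∈ fastEvent S v := by
  have hext : ∀ (n d : ℕ) (y : ℝ),
      (∃ u ∈ generation (offspring ξ) n, y ≤ wordLength S (position (steps ξ) u)) →
      ∃ u ∈ generation (offspring ξ) (n + d),
        y ≤ wordLength S (position (steps ξ) u) + d * M := by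
    intro n d y ⟨u, hu, hy⟩
    induction d with
    | zero => exact ⟨u, hu, by simpa using hy⟩
    | succ d ih =>
      obtain ⟨w, hw, hyw⟩ := ih
      refine ⟨0 :: w, mem_generation_succ.2 ⟨w, hw, 0, hpos w, rfl⟩, ?_⟩
      have h1 := wordLength_le_mul_right hS (position (steps ξ) w) (steps ξ (0 :: w))
      have h2 : (wordLength S (position (steps ξ) w) : ℝ)
          ≤ wordLength S (position (steps ξ) (0 :: w)) + M := by
        have : wordLength S (steps ξ (0 :: w)) ≤ M := hM (0 :: w)
        rw [position]
        exact_mod_cast h1.trans (by omega)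
      push_cast
      linarith
  refine ⟨C + m * M + ⌈|v| * m⌉₊, fun n => ?_⟩
  obtain ⟨u, hu, hy⟩ := h (n / m)
  obtain ⟨w, hw, hyw⟩ := hext (n / m * m) (n % m) (v * ((n / m * m : ℕ) : ℝ) - C)
    ⟨u, hu, by linarith⟩
  have hn : n / m * m + n % m = n := Nat.div_add_mod' n m
  rw [hn] at hw
  refine ⟨w, hw, ?_⟩
  have hn' : (n : ℝ) = ((n / m * m : ℕ) : ℝ) + ((n % m : ℕ) : ℝ) := by exact_mod_cast hn.symm
  have hmod : ((n % m : ℕ) : ℝ) ≤ m := by exact_mod_cast (Nat.mod_lt n hm).le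
  have hmod0 : (0 : ℝ) ≤ ((n % m : ℕ) : ℝ) := Nat.cast_nonneg _
  have h1 : v * ((n % m : ℕ) : ℝ) ≤ |v| * m :=
    mul_le_mul (le_abs_self v) hmod hmod0 (abs_nonneg v)
  have h2 : ((n % m : ℕ) : ℝ) * M ≤ m * M := mul_le_mul_of_nonneg_right hmod (Nat.cast_nonneg M)
  have hceil : |v| * m ≤ (⌈|v| * m⌉₊ : ℝ) := Nat.le_ceil _
  rw [hn']
  push_cast at hyw hceil ⊢
  nlinarith

/-- If blocks of `m` generations of lines of descent with speed `v` are supercritical, then the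
speed `v` is attained almost surely. -/
lemma ae_mem_fastEvent (hS : Subgroup.closure S = ⊤)
    (hM : ∀ g, μ g ≠ 0 → wordLength S g ≤ M) (h0 : π 0 = 0) {ρ : ℝ}
    (hρ : HasSum (fun k : ℕ => (k : ℝ) * (π k).toReal) ρ) (hρ1 : 1 < ρ) {l : ℝ} (hl : 1 ≤ l)
    (hlρ : l < ρ) {m : ℕ} (hm : 0 < m) {v : ℝ}
    (hs : ∀ g, 1 ≤ ENNReal.ofReal l ^ m * (walkLaw μ m).toMeasure
      {x | (wordLength S g : ℝ) + m * v ≤ wordLength S (g * x)}) :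
    ∀ᵐ ξ ∂fieldLaw π μ, ξ ∈ fastEvent S v := by
  obtain ⟨δ, hδ0, hδ⟩ := exists_offspring_bound π hρ (zero_le_one.trans hl) hlρ
  have hL0 : ENNReal.ofReal l ^ m ≠ 0 :=
    pow_ne_zero _ (ENNReal.ofReal_pos.2 (by linarith)).ne'
  have hLtop : ENNReal.ofReal l ^ m ≠ ⊤ := ENNReal.pow_ne_top ENNReal.ofReal_ne_top
  set η : ℝ≥0∞ := min 1 (δ / ENNReal.ofReal l ^ m) with hη
  have hη0 : η ≠ 0 := by
    rw [hη]
    exact (lt_min one_pos (ENNReal.div_pos hδ0 hLtop)).ne'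
  have hηδ : ENNReal.ofReal l ^ m * η ≤ δ :=
    (mul_le_mul_right (min_le_right _ _) _).trans (ENNReal.mul_div_cancel hL0 hLtop).le
  have hchain := le_fieldLaw_chainEvent (S := S) (μ := μ) hl hδ hηδ (min_le_left _ _) hs
  -- The events `J j` decrease to an event that almost surely implies the claim.
  set D : ℕ → Set (List ℕ → ℕ × Γ) := fun i => {ξ | ∃ u ∈ generation (offspring ξ) (i * m),
    position (steps ξ) u ∈
      {x : Γ | v * ((i * m : ℕ) : ℝ) ≤ wordLength S x + (2 * M : ℕ)}} with hD
  set J : ℕ → Set (List ℕ → ℕ × Γ) := fun j => ⋂ i ∈ Set.Iic j, D i with hJ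
  have hJm : ∀ j, MeasurableSet (J j) := fun j =>
    MeasurableSet.biInter (Set.to_countable _) fun i _ => measurableSet_exists_generation _ _
  have hJη : ∀ j, η ≤ fieldLaw π μ (J j) := by
    intro j
    refine (hchain j 1).trans (measure_mono_ae ?_)
    filter_upwards [ae_fieldLaw_step_le hM] with ξ hξM hξ
    refine Set.mem_iInter₂.2 fun i hi => ?_
    obtain ⟨u, hu, hT⟩ := (mem_iterate_childEvent _ _ _ _).1 (chainEvent_subset S m _ hi 1 hξ)
    refine ⟨u, hu, ?_⟩
    simp only [Set.mem_ofPred_eq, one_mul, wordLength_one, Nat.cast_zero, zero_add] at hT ⊢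
    have h1 := wordLength_mul_le hS (steps ξ [] * position (steps ξ) u) (steps ξ u)⁻¹
    have h2 := wordLength_mul_le hS (steps ξ []) (position (steps ξ) u)
    rw [wordLength_inv hS] at h1
    have h3 : wordLength S (steps ξ []) ≤ M := hξM []
    have h4 : wordLength S (steps ξ u) ≤ M := hξM u
    have h5 : (wordLength S (steps ξ [] * position (steps ξ) u * (steps ξ u)⁻¹) : ℝ)
        ≤ wordLength S (position (steps ξ) u) + (2 * M : ℕ) := by
      exact_mod_cast (by omega)
    push_cast at h5 ⊢
    linarith
  have hJanti : Antitone J := fun j j' hjj' => Set.biInter_subset_biInter_left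
    (Set.Iic_subset_Iic.2 hjj')
  have hlim := tendsto_measure_iInter_atTop (μ := fieldLaw π μ)
    (fun j => (hJm j).nullMeasurableSet) hJanti ⟨0, measure_ne_top _ _⟩
  have hfast : η ≤ fieldLaw π μ (fastEvent S v) := by
    refine (ge_of_tendsto' hlim hJη).trans (measure_mono_ae ?_)
    filter_upwards [ae_fieldLaw_step_le hM, ae_fieldLaw_offspring_pos h0] with ξ hξM hξ0 hξ
    refine mem_fastEvent_of_multiples hS hm hξ0 hξM (C := 2 * M) fun i => ?_
    exact Set.mem_iInter₂.1 (Set.mem_iInter.1 hξ i) i (Set.mem_Iic.2 le_rfl)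
  have hmeas := measurableSet_fastEvent (S := S) v
  refine fieldLaw_eq_zero_of_inherited π h0 hρ hρ1 μ hmeas.compl
    (fun ξ hξ c hc h => hξ (mem_fastEvent_of_subtree hS hc h)) ?_
  change fieldLaw π μ (fastEvent S v)ᶜ < 1
  rw [prob_compl_eq_one_sub hmeas]
  exact ENNReal.sub_lt_self ENNReal.one_ne_top one_ne_zero
    (lt_of_lt_of_le (pos_iff_ne_zero.2 hη0) hfast).ne'

end Survival

/-! ### The first-moment upper bound -/

section UpperBound

open scoped ENNReal

variable {Γ : Type*} [Countable Γ] [MeasurableSpace Γ] [DiscreteMeasurableSpace Γ] [Group Γ]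
  {S : Set Γ} {μ : PMF Γ} {M : ℕ} {π : PMF ℕ}

lemma one_sub_one_sub_pow_le {q : ℝ≥0∞} (hq : q ≤ 1) (k : ℕ) : 1 - (1 - q) ^ k ≤ k * q := by
  have hqtop : q ≠ ⊤ := (hq.trans_lt ENNReal.one_lt_top).ne
  obtain ⟨y, hy0, rfl⟩ : ∃ y, 0 ≤ y ∧ q = ENNReal.ofReal y :=
    ⟨q.toReal, ENNReal.toReal_nonneg, (ENNReal.ofReal_toReal hqtop).symm⟩
  have hy1 : y ≤ 1 := by
    rwa [← ENNReal.ofReal_one, ENNReal.ofReal_le_ofReal_iff zero_le_one] at hq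
  rw [tsub_le_iff_right, ← ENNReal.ofReal_one, ← ENNReal.ofReal_sub _ hy0,
    ← ENNReal.ofReal_pow (by linarith), ← ENNReal.ofReal_natCast,
    ← ENNReal.ofReal_mul (Nat.cast_nonneg k),
    ← ENNReal.ofReal_add (by positivity) (pow_nonneg (by linarith) k)]
  refine ENNReal.ofReal_le_ofReal ?_
  have h := one_add_mul_le_pow (a := -y) (by linarith) k
  rw [← sub_eq_add_neg] at h
  linarith

lemma lintegral_natCast_offspring {ρ : ℝ}
    (hρ : HasSum (fun k : ℕ => (k : ℝ) * (π k).toReal) ρ) :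
    ∫⁻ k, (k : ℝ≥0∞) ∂π.toMeasure = ENNReal.ofReal ρ := by
  rw [lintegral_toMeasure, ← hρ.tsum_eq, ENNReal.ofReal_tsum_of_nonneg
    (fun k => mul_nonneg (Nat.cast_nonneg k) ENNReal.toReal_nonneg) hρ.summable]
  refine tsum_congr fun k => ?_
  rw [ENNReal.ofReal_mul (Nat.cast_nonneg k), ENNReal.ofReal_natCast,
    ENNReal.ofReal_toReal (π.apply_ne_top k), mul_comm]

/-- The probability that some particle of generation `n` is born in `T` is at most the expected
number of such particles. -/
lemma fieldLaw_iterate_childEvent_le {ρ : ℝ}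
    (hρ : HasSum (fun k : ℕ => (k : ℝ) * (π k).toReal) ρ) (T : Set Γ) (n : ℕ) (g : Γ) :
    fieldLaw π μ (childEvent^[n] (fun g' => {_ξ | g' ∈ T}) g)
      ≤ ENNReal.ofReal ρ ^ n * (walkLaw μ n).toMeasure {x | g * x ∈ T} := by
  induction n generalizing g with
  | zero =>
    rw [measure_eq_lintegral_indicator (walkLaw μ 0).toMeasure, lintegral_walkLaw_zero]
    by_cases hg : g ∈ T
    · have h1 : (1 : Γ) ∈ {x | g * x ∈ T} := by simpa using hg
      rw [Set.indicator_of_mem h1]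
      simpa using prob_le_one
    · simp [hg]
  | succ n ih =>
    have hK : ∀ g', MeasurableSet ({_ξ | g' ∈ T} : Set (List ℕ → ℕ × Γ)) := fun _ => .const _
    rw [Function.iterate_succ_apply',
      fieldLaw_childEvent π μ (measurableSet_iterate_childEvent hK n), add_comm n 1,
      walkLaw_add_apply, walkLaw_one, ← lintegral_const_mul _ Measurable.of_discrete]
    refine lintegral_mono fun x => ?_
    calc ∫⁻ k, (1 - (1 - fieldLaw π μ (childEvent^[n] (fun g' => {_ξ | g' ∈ T}) (g * x))) ^ k)
          ∂π.toMeasure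
        ≤ ∫⁻ k, (k : ℝ≥0∞) * fieldLaw π μ (childEvent^[n] (fun g' => {_ξ | g' ∈ T}) (g * x))
            ∂π.toMeasure := lintegral_mono fun k => one_sub_one_sub_pow_le prob_le_one k
      _ = ENNReal.ofReal ρ * fieldLaw π μ (childEvent^[n] (fun g' => {_ξ | g' ∈ T}) (g * x)) := by
          rw [lintegral_mul_const _ Measurable.of_discrete, lintegral_natCast_offspring hρ]
      _ ≤ ENNReal.ofReal ρ *
            (ENNReal.ofReal ρ ^ n * (walkLaw μ n).toMeasure {y | g * x * y ∈ T}) := by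
          gcongr
          exact ih (g * x)
      _ = _ := by
          rw [pow_add, pow_one, mul_assoc]
          simp [mul_assoc]

/-- Chernoff's bound for the length of the walk. -/
lemma walkLaw_tail_le (hS : Subgroup.closure S = ⊤)
    (hM : ∀ g, μ g ≠ 0 → wordLength S g ≤ M) (n : ℕ) {t : ℝ} (ht : 0 ≤ t) (z : ℝ) :
    (walkLaw μ n).toMeasure {x | z ≤ wordLength S x}
      ≤ ENNReal.ofReal (Real.exp (-(t * z)) * lengthMGF S μ n t) := by
  rw [ENNReal.ofReal_mul (Real.exp_pos _).le, ofReal_lengthMGF hS hM,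
    ← lintegral_const_mul _ Measurable.of_discrete, measure_eq_lintegral_indicator]
  refine lintegral_mono fun x => ?_
  by_cases hx : z ≤ wordLength S x
  · rw [Set.indicator_of_mem (by exact hx), ← ENNReal.ofReal_mul (Real.exp_pos _).le,
      ← Real.exp_add, Pi.one_apply, ← ENNReal.ofReal_one]
    refine ENNReal.ofReal_le_ofReal (Real.one_le_exp ?_)
    nlinarith
  · rw [Set.indicator_of_notMem (by exact hx)]
    exact zero_le

/-- A speed whose rate exceeds `log ρ` is almost surely not attained in late generations. -/
lemma ae_eventually_lt (hS : Subgroup.closure S = ⊤)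
    (hM : ∀ g, μ g ≠ 0 → wordLength S g ≤ M) {ρ : ℝ}
    (hρ : HasSum (fun k : ℕ => (k : ℝ) * (π k).toReal) ρ) (hρ1 : 1 < ρ) {x t : ℝ} (ht : 0 ≤ t)
    (hx : Real.log ρ < x * t - limLogMGF S μ t) :
    ∀ᵐ ξ ∂fieldLaw π μ, ∀ᶠ n : ℕ in atTop, ∀ u ∈ generation (offspring ξ) n,
      (wordLength S (position (steps ξ) u) : ℝ) < x * n := by
  set ε : ℝ := (x * t - limLogMGF S μ t - Real.log ρ) / 2 with hε
  have hε0 : 0 < ε := by rw [hε]; linarith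
  have hρ0 : 0 < ρ := by linarith
  set E : ℕ → Set (List ℕ → ℕ × Γ) := fun n => {ξ | ∃ u ∈ generation (offspring ξ) n,
    position (steps ξ) u ∈ {y : Γ | x * n ≤ wordLength S y}} with hE
  obtain ⟨n₀, hn₀⟩ : ∃ n₀ : ℕ, ∀ n ≥ n₀,
      fieldLaw π μ (E n) ≤ ENNReal.ofReal (Real.exp (t * (2 * M)) * Real.exp (-ε) ^ n) := by
    have hev : ∀ᶠ n : ℕ in atTop, logMGF S μ n t < limLogMGF S μ t + ε :=
      (tendsto_order.1 (tendsto_logMGF hS hM t)).2 _ (by linarith)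
    obtain ⟨n₀, hn₀⟩ := eventually_atTop.1 (hev.and (eventually_gt_atTop 0))
    refine ⟨n₀, fun n hn => ?_⟩
    obtain ⟨h1, h2⟩ := hn₀ n hn
    have hn0 : (0 : ℝ) < n := by exact_mod_cast h2
    rw [logMGF_eq, div_lt_iff₀ hn0, Real.log_lt_iff_lt_exp (lengthMGF_pos hS hM n t)] at h1
    set T : Set Γ := {y : Γ | x * n - 2 * M ≤ wordLength S y} with hT
    have h3 : fieldLaw π μ (E n)
        ≤ fieldLaw π μ (childEvent^[n] (fun g' => {_ξ | g' ∈ T}) 1) := by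
      refine measure_mono_ae ?_
      filter_upwards [ae_fieldLaw_step_le hM] with ξ hξM hξ
      obtain ⟨u, hu, hxu⟩ := hξ
      refine (mem_iterate_childEvent _ _ _ _).2 ⟨u, hu, ?_⟩
      simp only [hT, Set.mem_ofPred_eq, one_mul] at hxu ⊢
      have h1 := wordLength_le_mul_right hS (steps ξ [] * position (steps ξ) u) (steps ξ u)⁻¹
      have h2 := wordLength_le_mul_left hS (steps ξ []) (position (steps ξ) u)
      rw [wordLength_inv hS] at h1
      have h3 : wordLength S (steps ξ []) ≤ M := hξM []
      have h4 : wordLength S (steps ξ u) ≤ M := hξM u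
      have h5 : (wordLength S (position (steps ξ) u) : ℝ)
          ≤ wordLength S (steps ξ [] * position (steps ξ) u * (steps ξ u)⁻¹) + (2 * M : ℕ) := by
        exact_mod_cast (by omega)
      push_cast at h5
      linarith
    refine h3.trans ((fieldLaw_iterate_childEvent_le hρ T n 1).trans ?_)
    simp only [one_mul]
    refine (mul_le_mul_right (walkLaw_tail_le hS hM n ht _) _).trans ?_
    rw [← ENNReal.ofReal_pow hρ0.le, ← ENNReal.ofReal_mul (pow_pos hρ0 n).le]
    refine ENNReal.ofReal_le_ofReal ?_
    have e1 : ρ ^ n = Real.exp (n * Real.log ρ) := by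
      rw [Real.exp_nat_mul, Real.exp_log hρ0]
    calc ρ ^ n * (Real.exp (-(t * (x * n - 2 * M))) * lengthMGF S μ n t)
        ≤ Real.exp (n * Real.log ρ) * (Real.exp (-(t * (x * n - 2 * M))) *
            Real.exp ((limLogMGF S μ t + ε) * n)) := by
          rw [e1]
          gcongr
      _ = Real.exp (t * (2 * M)) * Real.exp (-ε) ^ n := by
          rw [← Real.exp_nat_mul, ← Real.exp_add, ← Real.exp_add, ← Real.exp_add]
          congr 1
          rw [hε]
          ring
  have hr : Real.exp (-ε) < 1 := (Real.exp_lt_exp.2 (by linarith : -ε < 0)).trans_eq Real.exp_zero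
  have hsum : ∑' n, fieldLaw π μ (E (n + n₀)) ≠ ⊤ := by
    have hsummable : Summable fun n : ℕ =>
        Real.exp (t * (2 * M)) * Real.exp (-ε) ^ (n + n₀) :=
      (((summable_nat_add_iff n₀).2
        (summable_geometric_of_lt_one (Real.exp_pos _).le hr)).mul_left _)
    refine ((ENNReal.tsum_le_tsum fun n => hn₀ (n + n₀) (by omega)).trans_lt ?_).ne
    rw [← ENNReal.ofReal_tsum_of_nonneg (fun n => by positivity) hsummable]
    exact ENNReal.ofReal_lt_top
  filter_upwards [ae_eventually_notMem hsum] with ξ hξ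
  rw [← Filter.map_add_atTop_eq_nat n₀, Filter.eventually_map]
  filter_upwards [hξ] with n hn u hu
  by_contra hcon
  exact hn ⟨u, hu, not_lt.1 hcon⟩

end UpperBound

/-! ### The speed of the maximal displacement -/

section Speed

variable {Γ : Type*} [Countable Γ] [MeasurableSpace Γ] [DiscreteMeasurableSpace Γ] [Group Γ]
  {S : Set Γ} {μ : PMF Γ} {M : ℕ} {π : PMF ℕ}

/-- Rational speeds below `vMax` are attained almost surely. -/
lemma ae_mem_fastEvent_of_lt_vMax (hS : Subgroup.closure S = ⊤)
    (hM : ∀ g, μ g ≠ 0 → wordLength S g ≤ M) {c : ENNReal} (hc : c ≠ 0) (hc1 : c ≤ 1) {K : ℕ}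
    (hA : AlmostAdditive S μ c K) (h0 : π 0 = 0) {ρ : ℝ}
    (hρ : HasSum (fun k : ℕ => (k : ℝ) * (π k).toReal) ρ) (hρ1 : 1 < ρ) {z : ℤ} {w : ℕ}
    (hw : 0 < w) (hv : (z / w : ℝ) < vMax S μ ρ) :
    ∀ᵐ ξ ∂fieldLaw π μ, ξ ∈ fastEvent S (z / w) := by
  have hctop : c ≠ ⊤ := (hc1.trans_lt ENNReal.one_lt_top).ne
  have hlog := Real.log_pos hρ1
  obtain ⟨x, b, hvx, hbρ, hb⟩ := exists_rateFunction_lt (limLogMGF_zero hS hM)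
    (mul_drift_le_limLogMGF hS hM) (drift_nonneg hS hM) hρ1 hv
  obtain ⟨a, hba, haρ⟩ := exists_between (max_lt hbρ hlog)
  obtain ⟨m, hm, hBm⟩ := exists_lt_scaledTail hS hM hc hc1 hA hw hvx hb
    ((le_max_left _ _).trans_lt hba)
  have ha0 : 0 ≤ a := (le_max_right b 0).trans hba.le
  refine ae_mem_fastEvent hS hM h0 hρ hρ1 (l := Real.exp a) (Real.one_le_exp ha0) ?_ hm fun g => ?_
  · rwa [← Real.lt_log_iff_exp_lt (by linarith)]
  · have h1 : ENNReal.ofReal (Real.exp (-(m * a))) ≤ scaledTail S μ c K m (m * (z / w)) := by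
      exact (ENNReal.ofReal_le_iff_le_toReal
        (ENNReal.mul_ne_top hctop (measure_ne_top _ _))).2 hBm.le
    calc (1 : ENNReal) = ENNReal.ofReal (Real.exp a) ^ m * ENNReal.ofReal (Real.exp (-(m * a))) := by
          rw [← ENNReal.ofReal_pow (Real.exp_pos _).le, ← Real.exp_nat_mul,
            ← ENNReal.ofReal_mul (Real.exp_pos _).le, ← Real.exp_add, add_neg_cancel,
            Real.exp_zero, ENNReal.ofReal_one]
      _ ≤ _ := by
          gcongr
          exact h1.trans (hA g m _)

lemma ae_tendsto_maxDisplacement (hS : Subgroup.closure S = ⊤)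
    (hM : ∀ g, μ g ≠ 0 → wordLength S g ≤ M) {c : ENNReal} (hc : c ≠ 0) (hc1 : c ≤ 1) {K : ℕ}
    (hA : AlmostAdditive S μ c K) (h0 : π 0 = 0) {ρ : ℝ}
    (hρ : HasSum (fun k : ℕ => (k : ℝ) * (π k).toReal) ρ) (hρ1 : 1 < ρ) :
    ∀ᵐ ξ ∂fieldLaw π μ, Tendsto
      (fun n : ℕ => (maxDisplacement S (offspring ξ) (steps ξ) n : ℝ) / n) atTop
      (𝓝 (vMax S μ ρ)) := by
  have hlow : ∀ᵐ ξ ∂fieldLaw π μ, ∀ q : ℚ, (q : ℝ) < vMax S μ ρ → ξ ∈ fastEvent S q := by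
    rw [ae_all_iff]
    intro q
    by_cases hq : (q : ℝ) < vMax S μ ρ
    · have e : (q : ℝ) = (q.num : ℝ) / (q.den : ℝ) := Rat.cast_def q
      rw [e] at hq ⊢
      filter_upwards [ae_mem_fastEvent_of_lt_vMax hS hM hc hc1 hA h0 hρ hρ1 q.pos hq] with ξ hξ _
        using hξ
    · exact .of_forall fun ξ h => absurd h hq
  have hupp : ∀ᵐ ξ ∂fieldLaw π μ, ∀ q : ℚ, vMax S μ ρ < q → ∀ᶠ n : ℕ in atTop,
      ∀ u ∈ generation (offspring ξ) n, (wordLength S (position (steps ξ) u) : ℝ) < q * n := by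
    rw [ae_all_iff]
    intro q
    by_cases hq : vMax S μ ρ < q
    · obtain ⟨t, ht, hqt⟩ := exists_lt_of_vMax_lt (limLogMGF_zero hS hM)
        (mul_drift_le_limLogMGF hS hM) (fun t ht => limLogMGF_le hS hM ht) (drift_nonneg hS hM)
        hρ1 hq
      filter_upwards [ae_eventually_lt hS hM hρ hρ1 ht hqt] with ξ hξ _ using hξ
    · exact .of_forall fun ξ h => absurd h hq
  have hv0 : 0 ≤ vMax S μ ρ := (drift_nonneg hS hM).trans
    (drift_le_vMax (limLogMGF_zero hS hM) (mul_drift_le_limLogMGF hS hM)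
      (fun t ht => limLogMGF_le hS hM ht) (drift_nonneg hS hM) ρ)
  filter_upwards [hlow, hupp] with ξ hξl hξu
  refine tendsto_order.2 ⟨fun y hy => ?_, fun y hy => ?_⟩
  · obtain ⟨q, hyq, hqv⟩ := exists_rat_btwn hy
    obtain ⟨C, hC⟩ := hξl q hqv
    have hlim : Tendsto (fun n : ℕ => (q : ℝ) - C / n) atTop (𝓝 (q - 0)) :=
      (tendsto_const_div_atTop_nhds_zero_nat (C : ℝ)).const_sub _
    rw [sub_zero] at hlim
    filter_upwards [(tendsto_order.1 hlim).1 y hyq, eventually_gt_atTop 0] with n hn hn0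
    refine hn.trans_le ?_
    obtain ⟨u, hu, h⟩ := hC n
    have hn' : (0 : ℝ) < n := by exact_mod_cast hn0
    have hmax : (wordLength S (position (steps ξ) u) : ℝ)
        ≤ maxDisplacement S (offspring ξ) (steps ξ) n := by
      exact_mod_cast Finset.le_sup (f := fun v => wordLength S (position (steps ξ) v)) hu
    rw [sub_le_iff_le_add, ← add_div, le_div_iff₀ hn']
    linarith
  · obtain ⟨q, hvq, hqy⟩ := exists_rat_btwn hy
    filter_upwards [hξu q hvq, eventually_gt_atTop 0] with n hn hn0
    refine lt_of_le_of_lt ?_ hqy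
    have hn' : (0 : ℝ) < n := by exact_mod_cast hn0
    rw [div_le_iff₀ hn']
    have hqn : (0 : ℝ) ≤ q * n := mul_nonneg (hv0.trans hvq.le) hn'.le
    have hfloor : maxDisplacement S (offspring ξ) (steps ξ) n ≤ ⌊(q : ℝ) * n⌋₊ :=
      Finset.sup_le fun u hu => Nat.le_floor (hn u hu).le
    exact (Nat.cast_le.2 hfloor).trans (Nat.floor_le hqn)

end Speed

/-- The field driving a branching random walk has independent, identically distributed entries. -/
lemma IsBranchingRandomWalk.map_eq_fieldLaw {Γ : Type*} [MeasurableSpace Γ] {Ω : Type*}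
    [MeasurableSpace Ω] {P : Measure Ω} [IsProbabilityMeasure P] {π : PMF ℕ} {μ : PMF Γ}
    {N : List ℕ → Ω → ℕ} {ζ : List ℕ → Ω → Γ} (h : IsBranchingRandomWalk P π μ N ζ) :
    P.map (fun ω v => (N v ω, ζ v ω)) = fieldLaw π μ := by
  have hN : Measurable fun ω v => N v ω := measurable_pi_lambda _ h.measurable_offspring
  have hζ : Measurable fun ω v => ζ v ω := measurable_pi_lambda _ h.measurable_step
  have h1 := (indepFun_iff_map_prod_eq_prod_map_map hN.aemeasurable hζ.aemeasurable).1
    h.indep_offspring_step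
  rw [h.indep_offspring.map_fun_eq_infinitePi_map h.measurable_offspring,
    h.indep_step.map_fun_eq_infinitePi_map h.measurable_step] at h1
  simp_rw [h.law_offspring, h.law_step] at h1
  have hzip : Measurable fun (p : (List ℕ → ℕ) × (List ℕ → Γ)) v => (p.1 v, p.2 v) := by fun_prop
  rw [fieldLaw, ← map_zip_infinitePi, ← h1, Measure.map_map hzip (hN.prodMk hζ)]
  rfl

end FreeProductBRW

theorem theorem1p1 {r : ℕ} {G : Fin r → Type*} [∀ k, Group (G k)] [∀ k, Finite (G k)]
    [MeasurableSpace (Monoid.CoprodI G)] [DiscreteMeasurableSpace (Monoid.CoprodI G)]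
    (S : ∀ k, Set (G k)) (hS_one : ∀ k, 1 ∉ S k) (hS : ∀ k, Subgroup.closure (S k) = ⊤)
    (α : PMF (Fin r)) (hα : ∀ k, 0 < α k) (μ : ∀ k, PMF (G k))
    (π : PMF ℕ) (hπ_zero : π 0 = 0)
    (ρ : ℝ) (hρ : HasSum (fun k : ℕ => (k : ℝ) * (π k).toReal) ρ) (hρ_one : 1 < ρ)
    {Ω : Type*} [MeasurableSpace Ω] (P : Measure Ω) [IsProbabilityMeasure P]
    (N : List ℕ → Ω → ℕ) (ζ : List ℕ → Ω → Monoid.CoprodI G)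
    (hBRW : FreeProductBRW.IsBranchingRandomWalk P π (FreeProductBRW.stepLaw α μ) N ζ) :
    ∀ᵐ ω ∂P, Tendsto
      (fun n : ℕ => (FreeProductBRW.maxDisplacement (FreeProductBRW.generators S)
        (fun v => N v ω) (fun v => ζ v ω) n : ℝ) / n)
      atTop
      (𝓝 (FreeProductBRW.vMax (FreeProductBRW.generators S)
        (FreeProductBRW.stepLaw α μ) ρ)) := by
  have := FreeProductBRW.countable_coprodI (G := G)
  obtain ⟨M, hM⟩ := FreeProductBRW.exists_stepLaw_wordLength_le
    (FreeProductBRW.generators S) α μ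
  obtain ⟨c, hc, hc1, K, hA⟩ := FreeProductBRW.exists_almostAdditive hS α hα μ
  have h := FreeProductBRW.ae_tendsto_maxDisplacement (FreeProductBRW.closure_generators hS) hM
    hc hc1 hA hπ_zero hρ hρ_one
  rw [← hBRW.map_eq_fieldLaw] at h
  exact ae_of_ae_map (measurable_pi_lambda _ fun v =>
    (hBRW.measurable_offspring v).prodMk (hBRW.measurable_step v)).aemeasurable h
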